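/- Let $d\ge 1$. For an open interval $I\subseteq\mathbb{R}$ and a $d$-times continuously differentiable curve $\gamma:I\to\mathbb{R}^d$ define, for $t\in I$ and $(t_1,\dots,t_d)\in I^d$, $$L_\gamma(t)=\det\bigl(\gamma'(t),\dots,\gamma^{(d)}(t)\bigr),\qquad \lambda_\gamma=|L_\gamma|^{\frac{2}{d(d+1)}},$$ and let $J_\gamma$ be the Jacobian determinant of the map $\Phi_\gamma(t_1,\dots,t_d)=\sum_{j=1}^d(-1)^j\gamma(t_j)$. For nonnegative Borel functions $g$ on $\mathbb{R}^{1+d}$ let $$X_\gamma g(t,x)=\int_{\mathbb{R}} g\bigl(s,x+s\gamma(t)\bigr)\,ds,\qquad (t,x)\in I\times\mathbb{R}^d .$$ Put $p_d=\frac{(d+1)(d+2)}{d^2+d+2}$, $q_d=\frac{d+2}{d}$ and $q_d'=\frac{d+2}{2}$. For all positive constants $C_\gamma,c_1,c_2$ there is a finite constant $C$, depending only on $d,C_\gamma,c_1,c_2$, with the following property. Let $I$ and $\gamma$ be as above and suppose that $$|J_\gamma(t_1,\dots,t_d)|\ \ge\ C_\gamma\prod_{j=1}^d|L_\gamma(t_j)|^{\frac1d}\prod_{1\le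 i<j\le d}|t_j-t_i|\qquad\text{for all }(t_1,\dots,t_d)\in I^d,$$ and that $c_1 f\le\lambda_\gamma\le c_2 f$ on $I$ for some function $f:I\to[0,\infty)$ that is log-concave, i.e. $f(\theta t_1+(1-\theta)t_2)\ge f(t_1)^{\theta}f(t_2)^{1-\theta}$ for all $t_1,t_2\in I$ and $0\le\theta\le1$ (with $0^0=1$). Then for all Borel sets $E,F\subseteq\mathbb{R}^{1+d}$ of finite Lebesgue measure, $$\bigl\langle \lambda_\gamma(t)^{\frac1{q_d}}X_\gamma\chi_E,\chi_F\bigr\rangle=\int_I\int_{\mathbb{R}^d}\lambda_\gamma(t)^{\frac1{q_d}}\,X_\gamma\chi_E(t,x)\,\chi_F(t,x)\,dx\,dt\ \le\ C\,|E|^{\frac1{p_d}}\,|F|^{\frac1{q_d'}} .$$ -/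

import Mathlib

open MeasureTheory Set
open scoped ENNReal NNReal

namespace RestrictedXray

/-- The torsion `L_γ(t) = det (γ'(t), …, γ^{(d)}(t))`; column `j : Fin d` is the derivative of
order `j + 1`. (On an open set this depends only on the values of `γ` there.) -/
noncomputable def torsion {d : ℕ} (γ : ℝ → Fin d → ℝ) (t : ℝ) : ℝ :=
  (Matrix.of fun i j : Fin d => iteratedDeriv ((j : ℕ) + 1) γ t i).det

/-- The density `λ_γ = |L_γ|^{2 / (d (d + 1))}` of affine arclength. -/
noncomputable def affineDensity {d : ℕ} (γ : ℝ → Fin d → ℝ) (t : ℝ) : ℝ :=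
  |torsion γ t| ^ ((2 : ℝ) / ((d : ℝ) * ((d : ℝ) + 1)))

/-- `Φ_γ(t_1, …, t_d) = ∑_{j=1}^d (-1)^j γ(t_j)`; the index `j : Fin d` stands for `j + 1`. -/
noncomputable def alternatingSum {d : ℕ} (γ : ℝ → Fin d → ℝ) (t : Fin d → ℝ) : Fin d → ℝ :=
  ∑ j : Fin d, (-1 : ℝ) ^ ((j : ℕ) + 1) • γ (t j)

/-- The Jacobian determinant `J_γ` of `Φ_γ`. -/
noncomputable def jacobian {d : ℕ} (γ : ℝ → Fin d → ℝ) (t : Fin d → ℝ) : ℝ :=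
  (fderiv ℝ (alternatingSum γ) t).det

/-- The geometric inequality on `I^d` with constant `c`:
`|J_γ(t_1, …, t_d)| ≥ c ∏_j |L_γ(t_j)|^{1/d} ∏_{i<j} |t_j - t_i|`. -/
def GeometricInequality {d : ℕ} (c : ℝ) (I : Set ℝ) (γ : ℝ → Fin d → ℝ) : Prop :=
  ∀ t : Fin d → ℝ, (∀ j, t j ∈ I) →
    c * (∏ j : Fin d, |torsion γ (t j)| ^ ((1 : ℝ) / (d : ℝ))) *
      (∏ i : Fin d, ∏ j ∈ Finset.Ioi i, |t j - t i|) ≤ |jacobian γ t|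

/-- Log-concavity of a nonnegative function on `I` (zeros are allowed). -/
def LogConcaveOn (I : Set ℝ) (f : ℝ → ℝ) : Prop :=
  (∀ t ∈ I, 0 ≤ f t) ∧
    ∀ t₁ ∈ I, ∀ t₂ ∈ I, ∀ θ : ℝ, 0 ≤ θ → θ ≤ 1 →
      f t₁ ^ θ * f t₂ ^ (1 - θ) ≤ f (θ * t₁ + (1 - θ) * t₂)

/-- The X-ray transform `X f(x, y) = ∫ f(s, x + s y) ds` of a nonnegative function. -/
noncomputable def xray {d : ℕ} (f : ℝ × (Fin d → ℝ) → ℝ≥0∞) (x y : Fin d → ℝ) : ℝ≥0∞ :=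
  ∫⁻ s : ℝ, f (s, x + s • y)

/-- The restricted X-ray transform `X_γ f(t, x) = X f(x, γ(t))`. -/
noncomputable def restrictedXray {d : ℕ} (γ : ℝ → Fin d → ℝ) (f : ℝ × (Fin d → ℝ) → ℝ≥0∞)
    (z : ℝ × (Fin d → ℝ)) : ℝ≥0∞ :=
  xray f z.2 (γ z.1)

/-- `p_d = (d + 1)(d + 2) / (d² + d + 2)`. -/
noncomputable def pExp (d : ℕ) : ℝ := (((d : ℝ) + 1) * ((d : ℝ) + 2)) / ((d : ℝ) ^ 2 + d + 2)

/-- `q_d = (d + 2) / d`. -/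
noncomputable def qExp (d : ℕ) : ℝ := ((d : ℝ) + 2) / (d : ℝ)

/-- `q_d' = (d + 2) / 2`, the exponent conjugate to `q_d`. -/
noncomputable def qExpDual (d : ℕ) : ℝ := ((d : ℝ) + 2) / 2

/-- The pairing `⟨λ_γ(t)^{1/q_d} X_γ χ_E, χ_F⟩`, an integral over `(t, x) ∈ I × ℝ^d` against
Lebesgue measure. It has nonnegative integrand and is taken in `[0, ∞]`. -/
noncomputable def weightedPairing {d : ℕ} (I : Set ℝ) (γ : ℝ → Fin d → ℝ)
    (E F : Set (ℝ × (Fin d → ℝ))) : ℝ≥0∞ :=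
  ∫⁻ z in I ×ˢ (univ : Set (Fin d → ℝ)),
    ENNReal.ofReal (affineDensity γ z.1 ^ (1 / qExp d)) *
      restrictedXray γ (E.indicator fun _ => 1) z * F.indicator (fun _ => 1) z

end RestrictedXray

/-! The argument is the method of refinements. With `λ_γ ^ (1/q_d)` replaced by the comparable
weight `w = f ^ (1/q_d)`, the pairing is the weighted measure `Ω` of the set of flags: incident
pairs of a point `(s, y)` of `E` and a line `s ↦ (s, x + s γ(t))` of `F`. A flag can be moved by
sliding the point along its line or by turning the line about its point. Put `α ~ Ω/|F|` and `β ~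
Ω/|E|`. Discarding flags from which too little weighted mass can be reached (less than `α` by
slides, less than a multiple of `β` by turns) costs at most half of `Ω` in `d + 1` rounds, so some
flag survives them all.

From a survivor, `d + 1` alternating moves lead to points of `E`. For a fixed final coordinate `s`,
the final `y` is a function of the `d` remaining parameters. If this map is injective and its
Jacobian dominates the density of the moves, the area formula and integration in `s` give `|E| ≳
α^(d+1) β^(d(d+1)/2)`, which is the theorem once `α` and `β` are substituted.

Injectivity (`endpoint_injOn`) is general position: by Rolle's theorem and the geometric inequality
any `d + 1` points of the curve are affinely independent, and two paths with the same end involve at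
most `d + 1` points.

The Jacobian is, up to the slide lengths, a determinant whose columns alternate between velocities
and increments of `γ`. Increments are integrals of velocities, and the determinant of velocities has
constant sign on decreasing tuples, so nothing cancels and the integral is bounded below on a well
separated box (`le_abs_det_mixedMatrix`). The separation is built into the moves: each must travel
at least `α/w` or `4β/w`. That this costs little for turns is where log-concavity enters first
(`setLIntegral_window_le`); it is used again to compare `w` inside an interval with its values at
both ends. The powers of `w` then match the density of the moves exactly.

Monotonicity of `w` is arranged beforehand: a log-concave function is unimodal, so the interval
splits into two monotone pieces, one of which is reflected. -/

namespace RestrictedXray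

/-! ### One-dimensional measure estimates -/

/-- In a set `S`, the points with less than `b` of the mass of `S` to their right carry mass at
most `b`. -/
theorem measure_setOf_measure_inter_Ioi_lt {ν : Measure ℝ} (hν : ∀ x, ν {x} = 0)
    (S : Set ℝ) (b : ℝ≥0∞) : ν {t ∈ S | ν (S ∩ Ioi t) < b} ≤ b := by
  set U : Set ℝ := {t | ν (S ∩ Ioi t) < b} with hU
  have hup : ∀ {x y : ℝ}, x ∈ U → x ≤ y → y ∈ U := fun {x y} hx hxy =>
    lt_of_le_of_lt (measure_mono (inter_subset_inter_right _ (Ioi_subset_Ioi hxy))) hx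
  -- `U` is an up-set, so up to a possible least point it is a countable union of rays starting at
  -- rationals in `U`. The traces of `S` on these rays form a directed family, each of mass less
  -- than `b`, and no measurability of `S` is needed.
  set Q : Set ℚ := {q | (q : ℝ) ∈ U}
  set Z : Set ℝ := {t ∈ U | ∀ q ∈ Q, t ≤ (q : ℝ)}
  have hZ : Z.Subsingleton := by
    have key : ∀ x ∈ Z, ∀ y ∈ Z, ¬ x < y := by
      intro x hx y hy hxy
      obtain ⟨q, h1, h2⟩ := exists_rat_btwn hxy
      exact absurd (hy.2 q (hup hx.1 h1.le)) (not_le.2 h2)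
    intro x hx y hy
    exact le_antisymm (not_lt.1 (key y hy x hx)) (not_lt.1 (key x hx y hy))
  have hZ0 : ν Z = 0 := by
    rcases hZ.eq_empty_or_singleton with h | ⟨x, h⟩
    · simp [h]
    · rw [h, hν]
  have hsub : {t ∈ S | ν (S ∩ Ioi t) < b} ⊆ (⋃ q ∈ Q, S ∩ Ioi (q : ℝ)) ∪ Z := by
    rintro t ⟨htS, htU⟩
    by_cases h : ∀ q ∈ Q, t ≤ (q : ℝ)
    · exact Or.inr ⟨htU, h⟩
    · push Not at h
      obtain ⟨q, hq, hqt⟩ := h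
      exact Or.inl (mem_biUnion hq ⟨htS, hqt⟩)
  calc ν {t ∈ S | ν (S ∩ Ioi t) < b} ≤ ν ((⋃ q ∈ Q, S ∩ Ioi (q : ℝ)) ∪ Z) := measure_mono hsub
    _ ≤ ν (⋃ q ∈ Q, S ∩ Ioi (q : ℝ)) + ν Z := measure_union_le _ _
    _ = ν (⋃ q ∈ Q, S ∩ Ioi (q : ℝ)) := by rw [hZ0, add_zero]
    _ = ⨆ q ∈ Q, ν (S ∩ Ioi (q : ℝ)) := by
        apply measure_biUnion_eq_iSup (to_countable Q)
        intro p hp q hq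
        rcases le_total p q with h | h
        · exact ⟨p, hp, subset_rfl, inter_subset_inter_right _ (Ioi_subset_Ioi (by exact_mod_cast h))⟩
        · exact ⟨q, hq, inter_subset_inter_right _ (Ioi_subset_Ioi (by exact_mod_cast h)), subset_rfl⟩
    _ ≤ b := iSup₂_le fun q hq => le_of_lt hq

theorem measure_setOf_measure_inter_Iio_lt {ν : Measure ℝ} (hν : ∀ x, ν {x} = 0)
    (S : Set ℝ) (b : ℝ≥0∞) : ν {t ∈ S | ν (S ∩ Iio t) < b} ≤ b := by
  have e : ∀ s : Set ℝ, (ν.map (MeasurableEquiv.neg ℝ)) s = ν (Neg.neg ⁻¹' s) := fun s =>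
    (MeasurableEquiv.neg ℝ).map_apply s
  have h := measure_setOf_measure_inter_Ioi_lt (ν := ν.map (MeasurableEquiv.neg ℝ))
    (fun x => by rw [e]; simpa using hν (-x)) (Neg.neg ⁻¹' S) b
  rw [e] at h
  convert h using 2
  ext t
  simp only [mem_ofPred_eq, mem_preimage, neg_neg, e]
  have : (Neg.neg ⁻¹' (Neg.neg ⁻¹' S ∩ Ioi (-t)) : Set ℝ) = S ∩ Iio t := by
    ext x; simp
  rw [this]

/-- Log-concavity for positive functions, in the form in which all three parameters vary. -/
theorem LogConcaveOn.rpow {I : Set ℝ} {f : ℝ → ℝ} (hf : LogConcaveOn I f) {r : ℝ} (hr : 0 ≤ r) :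
    LogConcaveOn I (fun t => f t ^ r) := by
  refine ⟨fun t ht => Real.rpow_nonneg (hf.1 t ht) _, fun t₁ h₁ t₂ h₂ θ h0 hθ => ?_⟩
  have a := hf.1 t₁ h₁
  have b := hf.1 t₂ h₂
  have : (f t₁ ^ r) ^ θ * (f t₂ ^ r) ^ (1 - θ) = (f t₁ ^ θ * f t₂ ^ (1 - θ)) ^ r := by
    rw [Real.mul_rpow (by positivity) (by positivity), ← Real.rpow_mul a, ← Real.rpow_mul a,
      ← Real.rpow_mul b, ← Real.rpow_mul b, mul_comm θ, mul_comm (1 - θ)]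
  simp only [this]
  exact Real.rpow_le_rpow (by positivity) (hf.2 t₁ h₁ t₂ h₂ θ h0 hθ) hr

theorem LogConcaveOn.concaveOn_log {I : Set ℝ} {f : ℝ → ℝ} (hI : I.OrdConnected)
    (hf : LogConcaveOn I f) (hpos : ∀ t ∈ I, 0 < f t) : ConcaveOn ℝ I (fun t => Real.log (f t)) := by
  refine ⟨convex_iff_ordConnected.2 hI, fun x hx y hy a b ha hb _ => ?_⟩
  have hb' : b = 1 - a := by linarith
  subst hb'
  have h := hf.2 x hx y hy a ha (by linarith)
  have h1 := Real.rpow_pos_of_pos (hpos x hx) a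
  have h2 := Real.rpow_pos_of_pos (hpos y hy) (1 - a)
  have := Real.log_le_log (by positivity) h
  rw [Real.log_mul h1.ne' h2.ne', Real.log_rpow (hpos x hx), Real.log_rpow (hpos y hy)] at this
  simpa using this

/-- Midpoint form of log-concavity together with monotonicity. -/
theorem LogConcaveOn.mul_le_sq {I : Set ℝ} {w : ℝ → ℝ} (hI : I.OrdConnected)
    (hlc : LogConcaveOn I w) (hmono : MonotoneOn w I) {a b u : ℝ} (ha : a ∈ I) (hb : b ∈ I)
    (hu : (a + b) / 2 ≤ u) (hub : u ≤ b) (_ : a ≤ b) : w a * w b ≤ w u ^ 2 := by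
  have huI : u ∈ I := hI.out ha hb ⟨by linarith, hub⟩
  have hmI : (a + b) / 2 ∈ I := hI.out ha hb ⟨by linarith, by linarith⟩
  have h := hlc.2 a ha b hb (1 / 2) (by norm_num) (by norm_num)
  have e : (1 / 2 : ℝ) * a + (1 - 1 / 2) * b = (a + b) / 2 := by ring
  rw [e, show (1 - 1 / 2 : ℝ) = 1 / 2 by norm_num, ← Real.sqrt_eq_rpow, ← Real.sqrt_eq_rpow] at h
  have h2 := h.trans (hmono hmI huI hu)
  have := pow_le_pow_left₀ (by positivity) h2 2
  rwa [mul_pow, Real.sq_sqrt (hlc.1 a ha), Real.sq_sqrt (hlc.1 b hb)] at this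

/-- A log-concave density with mass at least `b` to the left of `t` has mass at most `b`
on the window of length `b / (e w(t))` to the right of `t`. -/
theorem setLIntegral_window_le {I : Set ℝ} {w : ℝ → ℝ} (hI : I.OrdConnected) (hIm : MeasurableSet I)
    (hpos : ∀ t ∈ I, 0 < w t) (hlc : LogConcaveOn I w) {b : ℝ} (hb : 0 < b) {t : ℝ} (ht : t ∈ I)
    (hleft : ENNReal.ofReal b ≤ ∫⁻ r in I ∩ Iio t, ENNReal.ofReal (w r)) :
    ∫⁻ r in I ∩ Ioo t (t + b / (Real.exp 1 * w t)), ENNReal.ofReal (w r) ≤ ENNReal.ofReal b := by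
  have hwt := hpos t ht
  have he := Real.exp_pos 1
  set δ := b / (Real.exp 1 * w t) with hδ
  have hδ0 : 0 < δ := by positivity
  -- If `w` grew by a factor `e` over a distance `η < δ`, concavity of `log w` would force `w x ≤ w
  -- t * exp ((x - t) / η)` to the left of `t`. The mass there would be at most `w t * η < b / e`,
  -- contradicting `hleft`.
  have key : ∀ r ∈ I ∩ Ioo t (t + δ), w r ≤ Real.exp 1 * w t := by
    rintro r ⟨hr, hr1, hr2⟩
    by_contra! hlt
    have hc := hlc.concaveOn_log hI hpos
    set η := r - t with hη
    have hη0 : 0 < η := by rw [hη]; linarith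
    have hbound : ∀ x ∈ I ∩ Iio t, w x ≤ w t * Real.exp (-(t / η)) * Real.exp (1 / η * x) := by
      rintro x ⟨hx, hxt⟩
      have hxt' : 0 < t - x := sub_pos.2 hxt
      have hs := hc.slope_anti_adjacent hx hr hxt hr1
      have h1 : 1 ≤ Real.log (w r) - Real.log (w t) := by
        have := Real.log_le_log (by positivity) hlt.le
        rw [Real.log_mul he.ne' hwt.ne', Real.log_exp] at this
        linarith
      have h2 : 1 / η ≤ (Real.log (w t) - Real.log (w x)) / (t - x) :=
        (div_le_div_of_nonneg_right h1 hη0.le).trans hs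
      rw [le_div_iff₀ hxt'] at h2
      have h3 : Real.log (w x) ≤ Real.log (w t) + (-(t / η) + 1 / η * x) := by
        have : 1 / η * (t - x) = t / η - 1 / η * x := by ring
        linarith
      rw [mul_assoc, ← Real.exp_add, ← Real.exp_log (hpos x hx)]
      conv_rhs => rw [← Real.exp_log hwt]
      rw [← Real.exp_add]
      exact Real.exp_le_exp.2 h3
    have hint : ∫⁻ x in Iic t, ENNReal.ofReal (w t * Real.exp (-(t / η)) * Real.exp (1 / η * x))
        = ENNReal.ofReal (w t * η) := by
      rw [← ofReal_integral_eq_lintegral_ofReal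
        ((integrableOn_exp_mul_Iic (by positivity) _).const_mul _)
        (Filter.Eventually.of_forall fun x => by positivity), integral_const_mul,
        integral_exp_mul_Iic (by positivity)]
      congr 1
      rw [mul_assoc, ← mul_div_assoc, ← Real.exp_add]
      have : -(t / η) + 1 / η * t = 0 := by ring
      rw [this, Real.exp_zero]; field_simp
    have : ENNReal.ofReal b ≤ ENNReal.ofReal (w t * η) := by
      refine hleft.trans (le_trans ?_ hint.le)
      refine (setLIntegral_mono_ae' (hIm.inter measurableSet_Iio) (Filter.Eventually.of_forall
        fun x hx => ENNReal.ofReal_le_ofReal (hbound x hx))).trans ?_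
      exact lintegral_mono_set fun x hx => mem_Iic.2 (mem_Iio.1 hx.2).le
    rw [ENNReal.ofReal_le_ofReal_iff (by positivity)] at this
    have h4 : η < δ := by rw [hη]; linarith
    have h5 : w t * η < w t * δ := by gcongr
    have h6 : w t * δ = b / Real.exp 1 := by rw [hδ]; field_simp
    have h7 : b / Real.exp 1 ≤ b := div_le_self hb.le (Real.one_le_exp zero_le_one)
    linarith
  calc ∫⁻ r in I ∩ Ioo t (t + δ), ENNReal.ofReal (w r)
      ≤ ∫⁻ r in I ∩ Ioo t (t + δ), ENNReal.ofReal (Real.exp 1 * w t) :=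
        setLIntegral_mono_ae' (hIm.inter measurableSet_Ioo) (Filter.Eventually.of_forall
          fun x hx => ENNReal.ofReal_le_ofReal (key x hx))
    _ ≤ ∫⁻ r in Ioo t (t + δ), ENNReal.ofReal (Real.exp 1 * w t) :=
        lintegral_mono_set inter_subset_right
    _ = ENNReal.ofReal b := by
        rw [setLIntegral_const, Real.volume_Ioo, ← ENNReal.ofReal_mul (by positivity)]
        congr 1
        rw [hδ]; field_simp; ring

/-- Points of `S` from which only little of `S` lies at distance at least `a` to the right. -/
theorem volume_setOf_inter_Ici_add_lt (S : Set ℝ) {a : ℝ} (ha : 0 ≤ a) :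
    volume {s ∈ S | volume (S ∩ Ici (s + a)) < ENNReal.ofReal a} ≤ ENNReal.ofReal (2 * a) := by
  refine (measure_mono ?_).trans (measure_setOf_measure_inter_Ioi_lt (ν := volume) (by simp) S _)
  rintro s ⟨hs, h⟩
  refine ⟨hs, ?_⟩
  have : S ∩ Ioi s ⊆ Ico s (s + a) ∪ (S ∩ Ici (s + a)) := by
    rintro x ⟨hx, hxs⟩
    rcases lt_or_ge x (s + a) with h' | h'
    · exact Or.inl ⟨le_of_lt hxs, h'⟩
    · exact Or.inr ⟨hx, h'⟩
  calc volume (S ∩ Ioi s) ≤ volume (Ico s (s + a)) + volume (S ∩ Ici (s + a)) :=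
        (measure_mono this).trans (measure_union_le _ _)
    _ < ENNReal.ofReal a + ENNReal.ofReal a := by
        rw [Real.volume_Ico, add_sub_cancel_left]
        exact ENNReal.add_lt_add_left ENNReal.ofReal_ne_top h
    _ = ENNReal.ofReal (2 * a) := by rw [← ENNReal.ofReal_add ha ha, two_mul]

/-- Weighted version of `volume_setOf_inter_Ici_add_lt` for a log-concave weight. -/
theorem measure_setOf_inter_Ici_window_lt {I : Set ℝ} {w : ℝ → ℝ} (hI : I.OrdConnected)
    (hIm : MeasurableSet I) (hpos : ∀ t ∈ I, 0 < w t)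
    (hlc : LogConcaveOn I w) {b : ℝ} (hb : 0 < b) {S : Set ℝ} (hSI : S ⊆ I) {ν : Measure ℝ}
    (hν : ν = (volume.restrict I).withDensity fun t => ENNReal.ofReal (w t)) :
    ν {t ∈ S | ν (S ∩ Ici (t + b / (Real.exp 1 * w t))) < ENNReal.ofReal b}
      ≤ ENNReal.ofReal (3 * b) := by
  have hν0 : ∀ x, ν {x} = 0 := fun x => by
    rw [hν]
    exact withDensity_absolutelyContinuous _ _ (le_antisymm
      ((Measure.restrict_apply_le _ _).trans (by simp)) zero_le)
  have hνapp : ∀ A, MeasurableSet A → ν A = ∫⁻ r in I ∩ A, ENNReal.ofReal (w r) := fun A hA => by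
    rw [hν, withDensity_apply _ hA, Measure.restrict_restrict hA, inter_comm]
  have hsub : {t ∈ S | ν (S ∩ Ici (t + b / (Real.exp 1 * w t))) < ENNReal.ofReal b} ⊆
      {t ∈ S | ν (S ∩ Iio t) < ENNReal.ofReal b} ∪
        {t ∈ S | ν (S ∩ Ioi t) < ENNReal.ofReal (2 * b)} := by
    rintro t ⟨hS', h⟩
    -- Points with little mass on their left cost `b`. For the others the window carries at most
    -- `b`, so little mass beyond the window means less than `2 * b` to the right, which costs
    -- another `2 * b`.
    by_cases hl : ν (S ∩ Iio t) < ENNReal.ofReal b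
    · exact Or.inl ⟨hS', hl⟩
    right
    refine ⟨hS', ?_⟩
    rw [not_lt] at hl
    set δ := b / (Real.exp 1 * w t)
    have hwin : ν (Ioo t (t + δ)) ≤ ENNReal.ofReal b := by
      rw [hνapp _ measurableSet_Ioo]
      refine setLIntegral_window_le hI hIm hpos hlc hb (hSI hS') (hl.trans ?_)
      rw [← hνapp _ measurableSet_Iio]
      exact measure_mono inter_subset_right
    have : S ∩ Ioi t ⊆ Ioo t (t + δ) ∪ (S ∩ Ici (t + δ)) := by
      rintro x ⟨hx, hxs⟩
      rcases lt_or_ge x (t + δ) with h' | h'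
      · exact Or.inl ⟨hxs, h'⟩
      · exact Or.inr ⟨hx, h'⟩
    calc ν (S ∩ Ioi t) ≤ ν (Ioo t (t + δ)) + ν (S ∩ Ici (t + δ)) :=
          (measure_mono this).trans (measure_union_le _ _)
      _ < ENNReal.ofReal b + ENNReal.ofReal b :=
          ENNReal.add_lt_add_of_le_of_lt (ne_top_of_le_ne_top ENNReal.ofReal_ne_top hwin) hwin h
      _ = ENNReal.ofReal (2 * b) := by rw [← ENNReal.ofReal_add hb.le hb.le, two_mul]
  calc _ ≤ ENNReal.ofReal b + ENNReal.ofReal (2 * b) :=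
        (measure_mono hsub).trans ((measure_union_le _ _).trans (add_le_add
          (measure_setOf_measure_inter_Iio_lt hν0 S _) (measure_setOf_measure_inter_Ioi_lt hν0 S _)))
    _ = ENNReal.ofReal (3 * b) := by
        rw [← ENNReal.ofReal_add hb.le (by positivity)]; congr 1; ring

/-- The data to which the general case is reduced: a curve `γ` with velocity `γ'` over an open
interval `I`, and a positive nondecreasing log-concave weight `w` that controls the determinants of
velocities. -/
structure MonotoneModel {d : ℕ} (C : ℝ) (I : Set ℝ) (γ γ' : ℝ → Fin d → ℝ) (w : ℝ → ℝ) :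
    Prop where
  dim_pos : 1 ≤ d
  const_pos : 0 < C
  isOpen : IsOpen I
  ordConnected : I.OrdConnected
  measurable_curve : Measurable γ
  measurable_weight : Measurable w
  hasDerivAt : ∀ t ∈ I, HasDerivAt γ (γ' t) t
  continuousOn : ContinuousOn γ' I
  weight_pos : ∀ t ∈ I, 0 < w t
  logConcave : LogConcaveOn I w
  monotone : MonotoneOn w I
  det_ge : ∀ z : Fin d → ℝ, (∀ j, z j ∈ I) →
    C * (∏ j, w (z j) ^ ((((d : ℝ) + 1) * ((d : ℝ) + 2)) / (2 * d))) *
      (∏ i : Fin d, ∏ j ∈ Finset.Ioi i, |z j - z i|) ≤ |(Matrix.of fun i j => γ' (z j) i).det|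

/-! ### Determinants of velocities -/

theorem prod_prod_Ioi_mul {d : ℕ} (f : Fin d → ℝ) :
    ∏ i : Fin d, ∏ j ∈ Finset.Ioi i, (f i * f j) = ∏ k, f k ^ (d - 1) := by
  have h1 : ∏ i : Fin d, ∏ j ∈ Finset.Ioi i, f j = ∏ j : Fin d, ∏ i ∈ Finset.Iio j, f j :=
    Finset.prod_comm' (by simp)
  simp_rw [Finset.prod_mul_distrib]
  rw [h1, ← Finset.prod_mul_distrib]
  refine Finset.prod_congr rfl fun k _ => ?_
  simp only [Finset.prod_const, Fin.card_Ioi, Fin.card_Iio, ← pow_add]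
  congr 1
  omega

/-- The determinant of averaged velocities is the average of the determinant. -/
theorem det_integral_eq {d : ℕ} (γ' : ℝ → Fin d → ℝ) (μ : Fin d → Measure ℝ)
    [∀ k, SigmaFinite (μ k)] (hint : ∀ k i, Integrable (fun t => γ' t i) (μ k)) :
    Integrable (fun z : Fin d → ℝ => (Matrix.of fun i j => γ' (z j) i).det) (Measure.pi μ) ∧
    (Matrix.of fun i k => ∫ t, γ' t i ∂(μ k)).det =
      ∫ z, (Matrix.of fun i j => γ' (z j) i).det ∂(Measure.pi μ) := by
  have hσ : ∀ σ : Equiv.Perm (Fin d),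
      Integrable (fun z : Fin d → ℝ => ∏ k, γ' (z k) (σ k)) (Measure.pi μ) := fun σ =>
    Integrable.fintype_prod (f := fun k t => γ' t (σ k)) fun k => hint k (σ k)
  simp only [Matrix.det_apply, Matrix.of_apply, Units.smul_def, ← Int.cast_smul_eq_zsmul ℝ]
  have hσ' : ∀ σ ∈ (Finset.univ : Finset (Equiv.Perm (Fin d))), Integrable (fun z : Fin d → ℝ =>
      ((Equiv.Perm.sign σ : ℤ) : ℝ) • ∏ k, γ' (z k) (σ k)) (Measure.pi μ) := fun σ _ =>
    (hσ σ).const_mul _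
  refine ⟨integrable_finsetSum _ hσ', ?_⟩
  rw [integral_finsetSum _ hσ']
  refine Finset.sum_congr rfl fun σ _ => ?_
  rw [integral_smul, integral_fintype_prod_eq_prod (fun k t => γ' t (σ k))]

namespace MonotoneModel

variable {d : ℕ} {C : ℝ} {I : Set ℝ} {γ γ' : ℝ → Fin d → ℝ} {w : ℝ → ℝ}

theorem det_ne_zero (h : MonotoneModel C I γ γ' w) {z : Fin d → ℝ} (hz : ∀ j, z j ∈ I)
    (hinj : Function.Injective z) : (Matrix.of fun i j => γ' (z j) i).det ≠ 0 := by
  have := h.det_ge z hz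
  rw [← abs_pos]
  refine lt_of_lt_of_le ?_ this
  refine mul_pos (mul_pos h.const_pos (Finset.prod_pos fun j _ =>
    Real.rpow_pos_of_pos (h.weight_pos _ (hz j)) _)) (Finset.prod_pos fun i _ =>
      Finset.prod_pos fun j hj => abs_pos.2 (sub_ne_zero.2 fun e => ?_))
  exact (Finset.mem_Ioi.1 hj).ne' (hinj e)

/-- The determinant has a constant sign on decreasing tuples. -/
theorem exists_sign (h : MonotoneModel C I γ γ' w) : ∃ ε : ℝ, |ε| = 1 ∧ ∀ z : Fin d → ℝ,
    Antitone z → (∀ j, z j ∈ I) →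
      ε * (Matrix.of fun i j => γ' (z j) i).det = |(Matrix.of fun i j => γ' (z j) i).det| := by
  set D : (Fin d → ℝ) → ℝ := fun z => (Matrix.of fun i j => γ' (z j) i).det with hD
  set S : Set (Fin d → ℝ) := {z | StrictAnti z ∧ ∀ j, z j ∈ I} with hS
  -- Strictly decreasing tuples form a convex, hence connected, set on which the determinant has no
  -- zero. A decreasing tuple that is not strict repeats a column and has determinant zero, so
  -- either sign suits it.
  have hconv : Convex ℝ S := by
    intro x hx y hy a b ha hb hab
    refine ⟨fun i j hij => ?_, fun j => (convex_iff_ordConnected.2 h.ordConnected) (hx.2 j) (hy.2 j)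
      ha hb hab⟩
    have h1 := hx.1 hij
    have h2 := hy.1 hij
    simp only [Pi.add_apply, Pi.smul_apply, smul_eq_mul]
    rcases ha.eq_or_lt with h0 | h0
    · subst h0; have : b = 1 := by linarith
      subst this; linarith
    · have := mul_lt_mul_of_pos_left h1 h0
      have := mul_le_mul_of_nonneg_left h2.le hb
      linarith
  have hcont : ContinuousOn D S := by
    have : ContinuousOn (fun z : Fin d → ℝ => Matrix.of fun i j => γ' (z j) i) S := by
      refine continuousOn_pi.2 fun i => continuousOn_pi.2 fun j => ?_
      exact (continuous_apply i).comp_continuousOn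
        (h.continuousOn.comp (continuous_apply j).continuousOn fun z hz => hz.2 j)
    exact (Continuous.matrix_det continuous_id).comp_continuousOn this
  have hne : ∀ z ∈ S, D z ≠ 0 := fun z hz => h.det_ne_zero hz.2 hz.1.injective
  have hdeg : ∀ z : Fin d → ℝ, Antitone z → (∀ j, z j ∈ I) → z ∉ S → D z = 0 := by
    intro z hz hzI hzS
    have : ¬ Function.Injective z := fun hi => hzS ⟨hz.strictAnti_of_injective hi, hzI⟩
    simp only [Function.Injective, not_forall] at this
    obtain ⟨i, j, he, hij⟩ := this
    exact Matrix.det_zero_of_column_eq hij fun k => by simp [he]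
  by_cases hp : ∀ z ∈ S, 0 ≤ D z
  · refine ⟨1, by simp, fun z hz hzI => ?_⟩
    change 1 * D z = |D z|
    by_cases hzS : z ∈ S
    · rw [one_mul, abs_of_nonneg (hp z hzS)]
    · simp [hdeg z hz hzI hzS]
  · push Not at hp
    obtain ⟨z₀, hz₀, hneg⟩ := hp
    refine ⟨-1, by simp, fun z hz hzI => ?_⟩
    change -1 * D z = |D z|
    by_cases hzS : z ∈ S
    · have : D z ≤ 0 := by
        by_contra! hpos
        obtain ⟨y, hy, hy0⟩ := hconv.isPreconnected.intermediate_value hz₀ hzS hcont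
          ⟨hneg.le, hpos.le⟩
        exact hne y hy hy0
      rw [abs_of_nonpos this]; ring
    · simp [hdeg z hz hzI hzS]

/-- Lower bound for the determinant at a decreasing tuple whose gaps are bounded below. -/
theorem le_abs_det (h : MonotoneModel C I γ γ' w) {β a : ℝ} (hβ : 0 < β) (ha : 0 < a)
    {z : Fin d → ℝ} (hz : ∀ j, z j ∈ I) (hanti : Antitone z) (haz : ∀ j, a ≤ w (z j))
    (hgap : ∀ i j, i < j → β / w (z j) ≤ z i - z j) :
    C * β ^ ((d : ℝ) * (d - 1) / 2) * (∏ j, w (z j) ^ 2) * a ≤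
      |(Matrix.of fun i j => γ' (z j) i).det| := by
  refine le_trans ?_ (h.det_ge z hz)
  have hd : 1 ≤ d := h.dim_pos
  have hd0 : (0 : ℝ) < d := by exact_mod_cast hd
  have hw : ∀ j, 0 < w (z j) := fun j => h.weight_pos _ (hz j)
  -- The gap bound is weakened to a symmetric one: for `i < j` the weight at `z j` is the smaller,
  -- so `β / w (z j)` dominates the geometric mean of `β / w (z i)` and `β / w (z j)`. Each index
  -- lies in `d - 1` pairs.
  have hpair : ∏ k, (Real.sqrt (β / w (z k))) ^ (d - 1) ≤
      ∏ i : Fin d, ∏ j ∈ Finset.Ioi i, |z j - z i| := by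
    rw [← prod_prod_Ioi_mul]
    refine Finset.prod_le_prod (fun i _ => Finset.prod_nonneg fun j _ => by positivity) fun i _ =>
      Finset.prod_le_prod (fun j _ => by positivity) fun j hj => ?_
    have hij := Finset.mem_Ioi.1 hj
    have hle : w (z j) ≤ w (z i) := h.monotone (hz j) (hz i) (hanti hij.le)
    have h1 : Real.sqrt (β / w (z i)) ≤ Real.sqrt (β / w (z j)) :=
      Real.sqrt_le_sqrt (div_le_div_of_nonneg_left hβ.le (hw j) hle)
    calc Real.sqrt (β / w (z i)) * Real.sqrt (β / w (z j))
        ≤ Real.sqrt (β / w (z j)) * Real.sqrt (β / w (z j)) := by gcongr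
      _ = β / w (z j) := Real.mul_self_sqrt (div_pos hβ (hw j)).le
      _ ≤ z i - z j := hgap i j hij
      _ ≤ |z j - z i| := by rw [abs_sub_comm]; exact le_abs_self _
  have hnn : 0 ≤ C * ∏ j, w (z j) ^ ((((d : ℝ) + 1) * ((d : ℝ) + 2)) / (2 * d)) :=
    mul_nonneg h.const_pos.le (Finset.prod_nonneg fun j _ => Real.rpow_nonneg (hw j).le _)
  refine le_trans ?_ (mul_le_mul_of_nonneg_left hpair hnn)
  have hd1 : ((d - 1 : ℕ) : ℝ) = (d : ℝ) - 1 := by rw [Nat.cast_sub hd]; simp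
  have hβprod : β ^ ((d : ℝ) * (d - 1) / 2) = ∏ _j : Fin d, β ^ (((d : ℝ) - 1) / 2) := by
    rw [Finset.prod_const, Finset.card_univ, Fintype.card_fin, ← Real.rpow_natCast,
      ← Real.rpow_mul hβ.le]
    congr 1; ring
  have haprod : a = ∏ _j : Fin d, a ^ ((1 : ℝ) / d) := by
    rw [Finset.prod_const, Finset.card_univ, Fintype.card_fin, ← Real.rpow_natCast,
      ← Real.rpow_mul ha.le, one_div_mul_cancel hd0.ne', Real.rpow_one]
  rw [hβprod]
  conv_lhs => rw [haprod]
  rw [mul_assoc, mul_assoc, mul_assoc, ← Finset.prod_mul_distrib, ← Finset.prod_mul_distrib,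
    ← Finset.prod_mul_distrib]
  refine mul_le_mul_of_nonneg_left (Finset.prod_le_prod (fun j _ => ?_) fun j _ => ?_)
    h.const_pos.le
  · have := hw j; positivity
  have hwj := hw j
  have e1 : Real.sqrt (β / w (z j)) ^ (d - 1) =
      β ^ (((d : ℝ) - 1) / 2) * w (z j) ^ (-(((d : ℝ) - 1) / 2)) := by
    rw [Real.sqrt_eq_rpow, ← Real.rpow_natCast, ← Real.rpow_mul (by positivity), hd1,
      show (1 / 2 : ℝ) * ((d : ℝ) - 1) = ((d : ℝ) - 1) / 2 by ring,
      Real.div_rpow hβ.le hwj.le, Real.rpow_neg hwj.le, div_eq_mul_inv]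
  -- The exponent is `(d - 1)/2 + 2 + 1/d`. The first part cancels the weights coming from the gaps;
  -- the last is bounded below by `a ^ (1/d)`, and the `d` copies of this multiply to `a`.
  have e2 : w (z j) ^ ((((d : ℝ) + 1) * ((d : ℝ) + 2)) / (2 * d)) =
      w (z j) ^ (((d : ℝ) - 1) / 2) * (w (z j) ^ 2 * w (z j) ^ ((1 : ℝ) / d)) := by
    rw [← Real.rpow_two, ← Real.rpow_add hwj, ← Real.rpow_add hwj]
    congr 1
    field_simp; ring
  have e3 : w (z j) ^ (((d : ℝ) - 1) / 2) * w (z j) ^ (-(((d : ℝ) - 1) / 2)) = 1 := by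
    rw [← Real.rpow_add hwj]; simp
  rw [e1, e2]
  calc β ^ (((d : ℝ) - 1) / 2) * (w (z j) ^ 2 * a ^ ((1 : ℝ) / d))
      ≤ β ^ (((d : ℝ) - 1) / 2) * (w (z j) ^ 2 * w (z j) ^ ((1 : ℝ) / d)) := by
        have := haz j
        gcongr
    _ = β ^ (((d : ℝ) - 1) / 2) * (w (z j) ^ 2 * w (z j) ^ ((1 : ℝ) / d)) *
        (w (z j) ^ (((d : ℝ) - 1) / 2) * w (z j) ^ (-(((d : ℝ) - 1) / 2))) := by rw [e3, mul_one]
    _ = _ := by ring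

end MonotoneModel

/-- The matrix whose columns alternate between velocities `γ'(b (k + 1))` and increments
`γ (b k) - γ (b (k + 2))`. -/
def mixedMatrix {d : ℕ} (γ γ' : ℝ → Fin d → ℝ) (b : ℕ → ℝ) : Matrix (Fin d) (Fin d) ℝ :=
  Matrix.of fun i k => if Even (k : ℕ) then γ' (b (k + 1)) i else γ (b k) i - γ (b (k + 2)) i

/-! ### Determinants of averaged velocities and mixed determinants. -/

namespace MonotoneModel

variable {d : ℕ} {C : ℝ} {I : Set ℝ} {γ γ' : ℝ → Fin d → ℝ} {w : ℝ → ℝ}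

/-- Lower bound for determinants of velocities averaged over consecutive intervals. -/
theorem le_abs_det_integral (h : MonotoneModel C I γ γ' w) (μ : Fin d → Measure ℝ)
    [∀ k, IsFiniteMeasure (μ k)] (hint : ∀ k i, Integrable (fun t => γ' t i) (μ k))
    {K U : Fin d → Set ℝ} (hK : ∀ k, ∀ᵐ t ∂(μ k), t ∈ K k) (hKI : ∀ k, K k ⊆ I)
    (hKanti : ∀ i j, i < j → ∀ x ∈ K i, ∀ y ∈ K j, y ≤ x) (hUm : ∀ k, MeasurableSet (U k))
    (hUK : ∀ k, U k ⊆ K k) {m : ℝ} (hm : ∀ z : Fin d → ℝ, (∀ k, z k ∈ U k) →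
      m ≤ |(Matrix.of fun i j => γ' (z j) i).det|) :
    m * ∏ k, (μ k).real (U k) ≤ |(Matrix.of fun i k => ∫ t, γ' t i ∂(μ k)).det| := by
  obtain ⟨ε, hε, hsign⟩ := h.exists_sign
  obtain ⟨hInt, heq⟩ := det_integral_eq γ' μ hint
  have hanti : ∀ z : Fin d → ℝ, (∀ k, z k ∈ K k) → Antitone z := fun z hz i j hij => by
    rcases hij.eq_or_lt with e | hlt
    · rw [e]
    · exact hKanti i j hlt _ (hz i) _ (hz j)
  have hae : ∀ᵐ z ∂(Measure.pi μ), ∀ k, z k ∈ K k := by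
    rw [ae_all_iff]
    exact fun k => (Measure.tendsto_eval_ae_ae (μ := μ) (i := k)).eventually (hK k)
  have hreal : (Measure.pi μ).real (univ.pi U) = ∏ k, (μ k).real (U k) := by
    simp only [Measure.real, Measure.pi_pi, ENNReal.toReal_prod]
  have hUmeas : MeasurableSet (univ.pi U) := MeasurableSet.univ_pi hUm
  -- Almost every tuple is decreasing, so after multiplication by the common sign the integrand is
  -- nonnegative and restricting to the box of the `U k` only decreases the integral.
  have h0 : 0 ≤ᵐ[Measure.pi μ] fun z => ε * (Matrix.of fun i j => γ' (z j) i).det := by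
    filter_upwards [hae] with z hz
    rw [hsign z (hanti z hz) fun k => hKI k (hz k)]
    exact abs_nonneg _
  calc m * ∏ k, (μ k).real (U k) = ∫ _z in univ.pi U, m ∂(Measure.pi μ) := by
        rw [setIntegral_const, hreal, smul_eq_mul, mul_comm]
    _ ≤ ∫ z in univ.pi U, ε * (Matrix.of fun i j => γ' (z j) i).det ∂(Measure.pi μ) := by
        refine setIntegral_mono_on (integrable_const _).integrableOn
          (hInt.const_mul ε).integrableOn hUmeas fun z hz => ?_
        have hzU : ∀ k, z k ∈ U k := fun k => hz k (mem_univ k)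
        have hzK : ∀ k, z k ∈ K k := fun k => hUK k (hzU k)
        rw [hsign z (hanti z hzK) fun k => hKI k (hzK k)]
        exact hm z hzU
    _ ≤ ∫ z, ε * (Matrix.of fun i j => γ' (z j) i).det ∂(Measure.pi μ) :=
        setIntegral_le_integral (hInt.const_mul ε) h0
    _ = ε * (Matrix.of fun i k => ∫ t, γ' t i ∂(μ k)).det := by rw [integral_const_mul, heq]
    _ ≤ |ε * (Matrix.of fun i k => ∫ t, γ' t i ∂(μ k)).det| := le_abs_self _
    _ = _ := by rw [abs_mul, hε, one_mul]

theorem hasDerivAt_apply (h : MonotoneModel C I γ γ' w) {t : ℝ} (ht : t ∈ I) (i : Fin d) :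
    HasDerivAt (fun t => γ t i) (γ' t i) t := hasDerivAt_pi.1 (h.hasDerivAt t ht) i

theorem integral_velocity (h : MonotoneModel C I γ γ' w) {a b : ℝ} (ha : a ∈ I) (hb : b ∈ I)
    (hab : a ≤ b) (i : Fin d) :
    IntegrableOn (fun t => γ' t i) (Ioc a b) ∧ ∫ t in Ioc a b, γ' t i = γ b i - γ a i := by
  have hsub : Icc a b ⊆ I := h.ordConnected.out ha hb
  have hc : ContinuousOn (fun t => γ' t i) (Icc a b) :=
    (continuous_apply i).comp_continuousOn (h.continuousOn.mono hsub)
  have hi : IntervalIntegrable (fun t => γ' t i) volume a b :=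
    ContinuousOn.intervalIntegrable (by rwa [uIcc_of_le hab])
  refine ⟨(intervalIntegrable_iff_integrableOn_Ioc_of_le hab).1 hi, ?_⟩
  rw [← intervalIntegral.integral_of_le hab]
  exact intervalIntegral.integral_eq_sub_of_hasDerivAt
    (fun t ht => h.hasDerivAt_apply (hsub (by rwa [uIcc_of_le hab] at ht)) i) hi

/-- Lower bound for the mixed determinant along a decreasing sequence of breakpoints
`b 1 > b 3 > b 5 > …` whose gaps are bounded below in terms of the weight. -/
theorem le_abs_det_mixedMatrix (h : MonotoneModel C I γ γ' w) {β : ℝ} (hβ : 0 < β) {b : ℕ → ℝ}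
    (hbI : ∀ l ≤ d / 2, b (2 * l + 1) ∈ I)
    (hgap : ∀ l < d / 2, b (2 * l + 3) + 4 * (β / w (b (2 * l + 3))) ≤ b (2 * l + 1)) :
    C * β ^ ((d : ℝ) * (d - 1) / 2) *
      (∏ k : Fin d, if Even (k : ℕ) then w (b (k + 1)) ^ 2 else β * w (b k)) *
        w (b (2 * (d / 2) + 1)) ≤ |(mixedMatrix γ γ' b).det| := by
  have hβw : ∀ {t}, t ∈ I → 0 < β / w t := fun ht => div_pos hβ (h.weight_pos _ ht)
  have hstep : ∀ l < d / 2, b (2 * l + 3) < b (2 * l + 1) := fun l hl => by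
    have h1 := hgap l hl
    have h2 := hβw (hbI (l + 1) hl)
    rw [show 2 * (l + 1) + 1 = 2 * l + 3 by ring] at h2
    linarith
  have hbanti : ∀ l m, l ≤ m → m ≤ d / 2 → b (2 * m + 1) ≤ b (2 * l + 1) := by
    intro l m hlm
    induction m, hlm using Nat.le_induction with
    | base => intro _; exact le_rfl
    | succ m hm ih =>
      intro hmd
      exact (hstep m hmd).le.trans (ih (by omega))
  have hbanti' : ∀ p q : ℕ, Odd p → Odd q → p ≤ q → q ≤ d + 1 → b q ≤ b p := by
    rintro p q ⟨l, rfl⟩ ⟨m, rfl⟩ hpq hq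
    exact hbanti l m (by omega) (by omega)
  have hbI' : ∀ p : ℕ, Odd p → p ≤ d + 1 → b p ∈ I := by
    rintro p ⟨l, rfl⟩ hp
    exact hbI l (by omega)
  have hgap' : ∀ p : ℕ, Odd p → p + 2 ≤ d + 1 → b (p + 2) + 4 * (β / w (b (p + 2))) ≤ b p := by
    rintro p ⟨l, rfl⟩ hp
    exact hgap l (by omega)
  -- Every column becomes an average of velocities: a Dirac mass yields a velocity, Lebesgue measure
  -- on an interval yields the increment over it.
  let μ : Fin d → Measure ℝ := fun k => if Even (k : ℕ) then Measure.dirac (b (k + 1))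
    else volume.restrict (Ioc (b (k + 2)) (b k))
  let K : Fin d → Set ℝ := fun k => if Even (k : ℕ) then {b (k + 1)} else Ioc (b (k + 2)) (b k)
  -- The third quarter of the interval. It lies in the upper half, where monotonicity and midpoint
  -- log-concavity give `w x ^ 2 ≥ w (b k) * w (b (k + 2))`. Since the interval has length at least
  -- `4 * (β / w (b (k + 2)))`, both the length of this quarter and its distance to either end are
  -- at least `β / w (b (k + 2))`.
  let U : Fin d → Set ℝ := fun k => if Even (k : ℕ) then {b (k + 1)} else
    Ioc (b (k + 2) + (b k - b (k + 2)) / 2) (b (k + 2) + 3 * (b k - b (k + 2)) / 4)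
  have hμe : ∀ k : Fin d, Even (k : ℕ) → μ k = Measure.dirac (b (k + 1)) := fun k hk => if_pos hk
  have hμo : ∀ k : Fin d, ¬ Even (k : ℕ) → μ k = volume.restrict (Ioc (b (k + 2)) (b k)) :=
    fun k hk => if_neg hk
  have hKe : ∀ k : Fin d, Even (k : ℕ) → K k = {b (k + 1)} := fun k hk => if_pos hk
  have hKo : ∀ k : Fin d, ¬ Even (k : ℕ) → K k = Ioc (b (k + 2)) (b k) := fun k hk => if_neg hk
  have hUe : ∀ k : Fin d, Even (k : ℕ) → U k = {b (k + 1)} := fun k hk => if_pos hk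
  have hUo : ∀ k : Fin d, ¬ Even (k : ℕ) → U k =
    Ioc (b (k + 2) + (b k - b (k + 2)) / 2) (b (k + 2) + 3 * (b k - b (k + 2)) / 4) :=
    fun k hk => if_neg hk
  have : ∀ k, IsFiniteMeasure (μ k) := fun k => by
    by_cases hk : Even (k : ℕ)
    · rw [hμe k hk]; infer_instance
    · rw [hμo k hk]; infer_instance
  -- facts about odd columns
  have hodd : ∀ k : Fin d, ¬ Even (k : ℕ) → Odd (k : ℕ) ∧ b k ∈ I ∧ b (k + 2) ∈ I ∧
      b (k + 2) + 4 * (β / w (b (k + 2))) ≤ b k ∧ b (k + 2) < b k := fun k hk => by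
    have ho := Nat.not_even_iff_odd.1 hk
    have hk2 : Odd ((k : ℕ) + 2) := by rcases ho with ⟨l, hl⟩; exact ⟨l + 1, by omega⟩
    have h1 := hbI' _ hk2 (by omega)
    have h2 := hgap' _ ho (by omega)
    exact ⟨ho, hbI' _ ho (by omega), h1, h2, by have := hβw h1; linarith⟩
  have heven : ∀ k : Fin d, Even (k : ℕ) → Odd ((k : ℕ) + 1) ∧ b (k + 1) ∈ I := fun k hk =>
    ⟨hk.add_one, hbI' _ hk.add_one (by omega)⟩
  have hKI : ∀ k, K k ⊆ I := fun k => by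
    by_cases hk : Even (k : ℕ)
    · rw [hKe k hk]; simpa using (heven k hk).2
    · rw [hKo k hk]
      obtain ⟨-, h1, h2, -, -⟩ := hodd k hk
      exact Ioc_subset_Icc_self.trans (h.ordConnected.out h2 h1)
  have hUK : ∀ k, U k ⊆ K k := fun k => by
    by_cases hk : Even (k : ℕ)
    · rw [hKe k hk, hUe k hk]
    · rw [hKo k hk, hUo k hk]
      obtain ⟨-, -, -, -, h4⟩ := hodd k hk
      exact Ioc_subset_Ioc (by linarith) (by linarith)
  -- every `K k` lies between two breakpoints
  have hlo : ∀ k, ∀ x ∈ K k, b (if Even (k : ℕ) then (k : ℕ) + 1 else k + 2) ≤ x := fun k x hx => by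
    by_cases hk : Even (k : ℕ)
    · rw [hKe k hk] at hx; rw [if_pos hk, mem_singleton_iff.1 hx]
    · rw [hKo k hk] at hx; rw [if_neg hk]; exact hx.1.le
  have hhi : ∀ k, ∀ x ∈ K k, x ≤ b (if Even (k : ℕ) then (k : ℕ) + 1 else k) := fun k x hx => by
    by_cases hk : Even (k : ℕ)
    · rw [hKe k hk] at hx; rw [if_pos hk, mem_singleton_iff.1 hx]
    · rw [hKo k hk] at hx; rw [if_neg hk]; exact hx.2
  have hKanti : ∀ i j, i < j → ∀ x ∈ K i, ∀ y ∈ K j, y ≤ x := fun i j hij x hx y hy => by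
    refine (hhi j y hy).trans (le_trans ?_ (hlo i x hx))
    have hij' : (i : ℕ) < j := hij
    have hj := j.2
    refine hbanti' _ _ ?_ ?_ ?_ ?_
    · split_ifs with hi
      · exact hi.add_one
      · rcases Nat.not_even_iff_odd.1 hi with ⟨l, hl⟩; exact ⟨l + 1, by omega⟩
    · split_ifs with hi
      · exact hi.add_one
      · exact Nat.not_even_iff_odd.1 hi
    · split_ifs with hi hj hj <;> (simp only [Nat.even_iff] at *; omega)
    · split_ifs <;> omega
  have hanti : ∀ z : Fin d → ℝ, (∀ k, z k ∈ K k) → Antitone z := fun z hz i j hij => by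
    rcases hij.eq_or_lt with e | hlt
    · rw [e]
    · exact hKanti i j hlt _ (hz i) _ (hz j)
  have hbot : b (2 * (d / 2) + 1) ∈ I := hbI _ le_rfl
  have hoddU : ∀ k : Fin d, ¬ Even (k : ℕ) → ∀ x ∈ U k, w (b k) * w (b (k + 2)) ≤ w x ^ 2 :=
    fun k hk x hx => by
      rw [hUo k hk] at hx
      obtain ⟨-, h1, h2, -, h4⟩ := hodd k hk
      rw [mul_comm]
      exact h.logConcave.mul_le_sq h.ordConnected h.monotone h2 h1 (by linarith [hx.1])
        (by linarith [hx.2]) h4.le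
  have hdet : (mixedMatrix γ γ' b) = Matrix.of fun i k => ∫ t, γ' t i ∂(μ k) := by
    ext i k
    by_cases hk : Even (k : ℕ)
    · simp [mixedMatrix, hμe k hk, hk]
    · obtain ⟨-, h1, h2, -, h4⟩ := hodd k hk
      simp only [mixedMatrix, Matrix.of_apply, hμo k hk, if_neg hk]
      exact ((h.integral_velocity h2 h1 h4.le i).2).symm
  rw [hdet]
  set a := w (b (2 * (d / 2) + 1)) with ha
  have ha0 : 0 < a := h.weight_pos _ hbot
  set P := ∏ k : Fin d, (if Even (k : ℕ) then w (b (k + 1)) ^ 2 else w (b k) * w (b (k + 2)))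
    with hP
  refine le_trans ?_ (h.le_abs_det_integral μ (fun k i => ?_) (K := K) (U := U)
    (m := C * β ^ ((d : ℝ) * (d - 1) / 2) * P * a) (fun k => ?_) hKI hKanti (fun k => ?_) hUK ?_)
  · have hreal : ∏ k : Fin d, (if Even (k : ℕ) then (1 : ℝ) else β / w (b (k + 2))) ≤
        ∏ k, (μ k).real (U k) := by
      refine Finset.prod_le_prod (fun k _ => ?_) fun k _ => ?_
      · split_ifs with hk
        · exact zero_le_one
        · exact (hβw (hodd k hk).2.2.1).le
      · by_cases hk : Even (k : ℕ)
        · simp [hμe k hk, hUe k hk, hk, Measure.real]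
        · obtain ⟨-, h1, h2, h3, h4⟩ := hodd k hk
          have hs : U k ⊆ Ioc (b (k + 2)) (b k) := by rw [← hKo k hk]; exact hUK k
          rw [if_neg hk, hμo k hk, Measure.real, Measure.restrict_apply
            (by rw [hUo k hk]; exact measurableSet_Ioc), inter_eq_left.2 hs, hUo k hk,
            Real.volume_Ioc, ENNReal.toReal_ofReal (by linarith)]
          linarith
    have hP0 : 0 ≤ P := Finset.prod_nonneg fun k _ => by
      split_ifs with hk
      · positivity
      · exact mul_nonneg (h.weight_pos _ (hodd k hk).2.1).le (h.weight_pos _ (hodd k hk).2.2.1).le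
    have hC := h.const_pos
    calc _ = C * β ^ ((d : ℝ) * (d - 1) / 2) * P * a *
          ∏ k : Fin d, (if Even (k : ℕ) then (1 : ℝ) else β / w (b (k + 2))) := by
          rw [mul_right_comm _ a, mul_assoc (C * _) P, hP, ← Finset.prod_mul_distrib]
          congr 2
          refine Finset.prod_congr rfl fun k _ => ?_
          split_ifs with hk
          · ring
          · have := (h.weight_pos _ (hodd k hk).2.2.1).ne'
            field_simp
      _ ≤ _ := mul_le_mul_of_nonneg_left hreal (by positivity)
  · by_cases hk : Even (k : ℕ)
    · rw [hμe k hk]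
      exact integrable_dirac (by simp)
    · obtain ⟨-, h1, h2, -, h4⟩ := hodd k hk
      rw [hμo k hk]
      exact (h.integral_velocity h2 h1 h4.le i).1
  · by_cases hk : Even (k : ℕ)
    · rw [hμe k hk, hKe k hk]; simp [ae_dirac_eq]
    · rw [hμo k hk, hKo k hk]
      exact ae_restrict_mem measurableSet_Ioc
  · by_cases hk : Even (k : ℕ)
    · rw [hUe k hk]; exact measurableSet_singleton _
    · rw [hUo k hk]; exact measurableSet_Ioc
  · intro z hz
    have hzK : ∀ k, z k ∈ K k := fun k => hUK k (hz k)
    have hzI : ∀ k, z k ∈ I := fun k => hKI k (hzK k)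
    have hza := hanti z hzK
    refine le_trans ?_ (h.le_abs_det hβ ha0 hzI hza (fun j => ?_) fun i j hij => ?_)
    · have hC := h.const_pos
      have : P ≤ ∏ j, w (z j) ^ 2 := by
        refine Finset.prod_le_prod (fun k _ => ?_) fun k _ => ?_
        · split_ifs with hk
          · positivity
          · exact mul_nonneg (h.weight_pos _ (hodd k hk).2.1).le
              (h.weight_pos _ (hodd k hk).2.2.1).le
        · split_ifs with hk
          · have := hz k
            rw [hUe k hk, mem_singleton_iff] at this
            rw [this]
          · exact hoddU k hk _ (hz k)
      gcongr
    · refine h.monotone hbot (hzI j) (le_trans ?_ (hlo j _ (hzK j)))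
      have hj := j.2
      refine hbanti' _ _ ?_ ⟨d / 2, rfl⟩ ?_ (by omega)
      · split_ifs with hi
        · exact hi.add_one
        · rcases Nat.not_even_iff_odd.1 hi with ⟨l, hl⟩; exact ⟨l + 1, by omega⟩
      · split_ifs with hi <;> (simp only [Nat.even_iff] at *; omega)
    · have hij' : (i : ℕ) < j := hij
      have hj := j.2
      -- By monotonicity only the neighbouring column matters. Exactly one of the two is an interval
      -- column, and the margin between its `U` and the common breakpoint supplies the gap.
      let p : Fin d := ⟨(j : ℕ) - 1, by omega⟩
      have hp1 : (p : ℕ) + 1 = j := by simp only [p]; omega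
      have hpi : z p ≤ z i := hza (by simp only [p, Fin.le_def]; omega)
      refine le_trans ?_ (sub_le_sub_right hpi _)
      by_cases hjE : Even (j : ℕ)
      · have hpO : ¬ Even (p : ℕ) := fun hpE => by
          rw [← hp1] at hjE; exact (Nat.not_even_iff_odd.2 hpE.add_one) hjE
        obtain ⟨-, h1, h2, h3, h4⟩ := hodd p hpO
        have e1 := hz j
        have e2 := hz p
        rw [hUe j hjE, mem_singleton_iff] at e1
        rw [hUo p hpO] at e2
        have e3 : b ((j : ℕ) + 1) = b (p + 2) := by rw [← hp1]
        rw [e3] at e1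
        rw [e1]
        have := e2.1
        have := hβw h2
        linarith
      · have hpE : Even (p : ℕ) := by
          by_contra hpO
          rw [← hp1] at hjE
          exact hjE (Nat.not_even_iff_odd.1 hpO).add_one
        obtain ⟨-, h1, h2, h3, h4⟩ := hodd j hjE
        have e1 := hz j
        have e2 := hz p
        rw [hUe p hpE, mem_singleton_iff, hp1] at e2
        rw [hUo j hjE] at e1
        rw [e2]
        have h5 : w (b (j + 2)) ≤ w (z j) := h.monotone h2 (hzI j) (by linarith [e1.1])
        have h6 : β / w (z j) ≤ β / w (b (j + 2)) :=
          div_le_div_of_nonneg_left hβ.le (h.weight_pos _ h2) h5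
        linarith [e1.2]

/-! ### General position -/

/-- A nontrivial affine relation makes the matrix with rows `(1, γ (x k))` singular, so some nonzero
affine functional vanishes at all `d + 1` points. By Rolle its derivative along the curve vanishes
at `d` intermediate points, whose velocities are linearly independent by `det_ne_zero`. The
functional is then constant, hence zero. -/
theorem eq_zero_of_sum_smul_eq_zero_of_strictMono (h : MonotoneModel C I γ γ' w)
    {x : Fin (d + 1) → ℝ} (hx : StrictMono x) (hxI : ∀ k, x k ∈ I) {m : Fin (d + 1) → ℝ}
    (hm0 : ∑ k, m k = 0) (hm1 : ∀ i, ∑ k, m k * γ (x k) i = 0) : m = 0 := by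
  by_contra hm
  let N : Matrix (Fin (d + 1)) (Fin (d + 1)) ℝ :=
    Matrix.of fun k i => (Fin.cons 1 (γ (x k)) : Fin (d + 1) → ℝ) i
  have hN : N.det = 0 := by
    refine Matrix.exists_vecMul_eq_zero_iff.1 ⟨m, hm, ?_⟩
    ext i
    refine Fin.cases ?_ (fun i => ?_) i
    · simpa [Matrix.vecMul, dotProduct, N] using hm0
    · simpa [Matrix.vecMul, dotProduct, N] using hm1 i
  obtain ⟨v, hv, hv0⟩ := Matrix.exists_mulVec_eq_zero_iff.2 hN
  have hzero : ∀ k, v 0 + ∑ i, v (Fin.succ i) * γ (x k) i = 0 := fun k => by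
    have := congrFun hv0 k
    simp only [Matrix.mulVec, dotProduct, N, Matrix.of_apply, Fin.sum_univ_succ, Fin.cons_zero,
      Fin.cons_succ, Pi.zero_apply, one_mul] at this
    simpa [mul_comm] using this
  have hder : ∀ t ∈ I, HasDerivAt (fun t => v 0 + ∑ i, v (Fin.succ i) * γ t i)
      (∑ i, v (Fin.succ i) * γ' t i) t := fun t ht => by
    have := HasDerivAt.fun_sum (u := Finset.univ) (A := fun i t => v (Fin.succ i) * γ t i)
      (fun i _ => (h.hasDerivAt_apply ht i).const_mul (v (Fin.succ i)))
    exact this.const_add _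
  have hex : ∀ k : Fin d, ∃ z ∈ Ioo (x k.castSucc) (x k.succ),
      ∑ i, v (Fin.succ i) * γ' z i = 0 := fun k => by
    have hsub : Icc (x k.castSucc) (x k.succ) ⊆ I := h.ordConnected.out (hxI _) (hxI _)
    exact exists_hasDerivAt_eq_zero (hx k.castSucc_lt_succ)
      (fun t ht => (hder t (hsub ht)).continuousAt.continuousWithinAt)
      ((hzero _).trans (hzero _).symm) fun t ht => hder t (hsub (Ioo_subset_Icc_self ht))
  choose z hz hz0 using hex
  have hzI : ∀ k, z k ∈ I := fun k =>
    h.ordConnected.out (hxI _) (hxI _) (Ioo_subset_Icc_self (hz k))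
  have hzm : StrictMono z := fun i j hij => by
    refine (hz i).2.trans_le (le_trans (hx.monotone ?_) (hz j).1.le)
    exact Fin.succ_le_castSucc_iff.2 hij
  have hvs : (fun i => v (Fin.succ i)) = 0 := by
    by_contra hne
    refine h.det_ne_zero hzI hzm.injective (Matrix.exists_vecMul_eq_zero_iff.1 ⟨_, hne, ?_⟩)
    ext k
    simpa [Matrix.vecMul, dotProduct] using hz0 k
  have hvs' : ∀ i, v (Fin.succ i) = 0 := congrFun hvs
  have hv00 : v 0 = 0 := by simpa [hvs'] using hzero 0
  exact hv (funext fun i => Fin.cases hv00 hvs' i)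

/-- Any `d + 1` points of the curve are affinely independent. -/
theorem eq_zero_of_sum_smul_eq_zero (h : MonotoneModel C I γ γ' w) {B : Finset ℝ}
    (hBI : (B : Set ℝ) ⊆ I) (hcard : B.card ≤ d + 1) {m : ℝ → ℝ} (hm0 : ∑ x ∈ B, m x = 0)
    (hm1 : ∀ i, ∑ x ∈ B, m x * γ x i = 0) : ∀ x ∈ B, m x = 0 := by
  intro x₀ hx₀
  have hinf : I.Infinite := infinite_of_mem_nhds x₀ (h.isOpen.mem_nhds (hBI hx₀))
  -- Smaller sets are padded to exactly `d + 1` points of `I`, with coefficient zero at the new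
  -- ones.
  obtain ⟨B₀, hB₀I, hB₀c⟩ := hinf.exists_subset_card_eq (d + 1)
  obtain ⟨B', hBB', hB'B, hB'c⟩ := Finset.exists_subsuperset_card_eq
    (Finset.subset_union_left (s₁ := B) (s₂ := B₀)) hcard
    (hB₀c ▸ Finset.card_le_card Finset.subset_union_right)
  have hB'I : (B' : Set ℝ) ⊆ I := fun y hy =>
    (Finset.mem_union.1 (hB'B hy)).elim (fun h => hBI h) fun h => hB₀I h
  set x := B'.orderEmbOfFin hB'c with hx
  have hsum : ∀ g : ℝ → ℝ, ∑ k, (if x k ∈ B then g (x k) else 0) = ∑ y ∈ B, g y := fun g => by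
    have : Finset.univ.map x.toEmbedding = B' := B'.map_orderEmbOfFin_univ hB'c
    have e := Finset.sum_map Finset.univ x.toEmbedding (fun y => if y ∈ B then g y else 0)
    rw [this, ← Finset.sum_filter] at e
    refine e.symm.trans ?_
    congr 1
    ext y; simp only [Finset.mem_filter]
    exact ⟨fun h => h.2, fun h => ⟨hBB' h, h⟩⟩
  have := h.eq_zero_of_sum_smul_eq_zero_of_strictMono (x := x) x.strictMono
    (fun k => hB'I (B'.orderEmbOfFin_mem hB'c k)) (m := fun k => if x k ∈ B then m (x k) else 0)
    (by rw [hsum, hm0]) (fun i => by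
      refine Eq.trans ?_ ((hsum (fun y => m y * γ y i)).trans (hm1 i))
      exact Finset.sum_congr rfl fun k _ => by split_ifs <;> simp)
  have hx₀' : x₀ ∈ Set.range x := by
    rw [hx, B'.range_orderEmbOfFin hB'c]; exact hBB' hx₀
  obtain ⟨k, hk⟩ := hx₀'
  have := congrFun this k
  simpa [hk, hx₀] using this

/-- A positive combination of few points of the curve determines the points and the
coefficients. -/
theorem eq_of_sum_smul_eq (h : MonotoneModel C I γ γ' w) {n : ℕ} {t t' c c' : Fin n → ℝ}
    (ht : StrictAnti t) (ht' : StrictAnti t') (htI : ∀ l, t l ∈ I) (htI' : ∀ l, t' l ∈ I)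
    (hc : ∀ l, 0 < c l) (hc' : ∀ l, 0 < c' l)
    (hcard : (Finset.univ.image t ∪ Finset.univ.image t').card ≤ d + 1)
    (hsum : ∑ l, c l = ∑ l, c' l) (hγ : ∑ l, c l • γ (t l) = ∑ l, c' l • γ (t' l)) :
    t = t' ∧ c = c' := by
  set B := Finset.univ.image t ∪ Finset.univ.image t' with hB
  -- The mass at `x` of the discrete measure `∑ c l δ_(t l)`. Affine independence forces the two
  -- measures to agree; positivity of the coefficients then identifies their supports.
  set M : (Fin n → ℝ) → (Fin n → ℝ) → ℝ → ℝ := fun c t x => ∑ l, if t l = x then c l else 0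
  have hM : ∀ (c t : Fin n → ℝ) (g : ℝ → ℝ), (∀ l, t l ∈ B) →
      ∑ x ∈ B, M c t x * g x = ∑ l, c l * g (t l) := fun c t g htB => by
    simp only [M, Finset.sum_mul]
    rw [Finset.sum_comm]
    refine Finset.sum_congr rfl fun l _ => ?_
    rw [Finset.sum_eq_single (t l)]
    · simp
    · intro x _ hx; simp [hx.symm]
    · intro hn; exact absurd (htB l) hn
  have htB : ∀ l, t l ∈ B := fun l => by simp [hB]
  have htB' : ∀ l, t' l ∈ B := fun l => by simp [hB]
  have hzero := h.eq_zero_of_sum_smul_eq_zero (B := B) (m := fun x => M c t x - M c' t' x)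
    (by
      intro x hx
      simp only [hB, Finset.coe_union, Finset.coe_image, Finset.coe_univ, image_univ, mem_union,
        mem_range] at hx
      rcases hx with ⟨l, rfl⟩ | ⟨l, rfl⟩
      exacts [htI l, htI' l]) hcard
    (by
      have h1 := hM c t (fun _ => 1) htB
      have h2 := hM c' t' (fun _ => 1) htB'
      simp only [mul_one] at h1 h2
      rw [Finset.sum_sub_distrib, h1, h2, hsum, sub_self])
    (fun i => by
      have := congrFun hγ i
      simp only [Finset.sum_apply, Pi.smul_apply, smul_eq_mul] at this
      simp only [sub_mul]
      rw [Finset.sum_sub_distrib, hM c t (fun x => γ x i) htB, hM c' t' (fun x => γ x i) htB',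
        this, sub_self])
  have hMt : ∀ (c t : Fin n → ℝ), StrictAnti t → ∀ l, M c t (t l) = c l := fun c t ht l => by
    simp only [M]
    rw [Finset.sum_eq_single l]
    · simp
    · intro k _ hk; simp [ht.injective.ne hk]
    · simp
  have hMn : ∀ (c t : Fin n → ℝ) (x : ℝ), x ∉ range t → M c t x = 0 := fun c t x hx =>
    Finset.sum_eq_zero fun l _ => if_neg fun e => hx ⟨l, e⟩
  have hr : range t = range t' := by
    apply Subset.antisymm
    · rintro _ ⟨l, rfl⟩
      by_contra hn
      have := hzero _ (htB l)
      simp only [hMt c t ht, hMn c' t' _ hn] at this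
      linarith [hc l]
    · rintro _ ⟨l, rfl⟩
      by_contra hn
      have := hzero _ (htB' l)
      simp only [hMt c' t' ht', hMn c t _ hn] at this
      linarith [hc' l]
  have htt : t = t' := by
    have h1 : StrictMono fun l => -t l := fun i j hij => neg_lt_neg (ht hij)
    have h2 : StrictMono fun l => -t' l := fun i j hij => neg_lt_neg (ht' hij)
    have : (fun l => -t l) = fun l => -t' l := (h1.range_inj h2).1 (by
      have e : ∀ s : Fin n → ℝ, range (fun l => -s l) = Neg.neg '' range s := fun s => by
        rw [← range_comp]; rfl
      rw [e, e, hr])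
    funext l
    exact neg_injective (congrFun this l)
  refine ⟨htt, funext fun l => ?_⟩
  have := hzero _ (htB l)
  rw [hMt c t ht] at this
  rw [htt, hMt c' t' ht'] at this
  linarith

end MonotoneModel

/-! ### Iterated integrals along sequences -/

/-- The sequence `c` with its first `r` entries replaced by `q`. -/
def replaceInit (r : ℕ) (c : ℕ → ℝ) (q : Fin r → ℝ) : ℕ → ℝ :=
  fun k => if h : k < r then q ⟨k, h⟩ else c k

theorem measurable_replaceInit (r : ℕ) (c : ℕ → ℝ) : Measurable (replaceInit r c) := by
  refine measurable_pi_lambda _ fun k => ?_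
  unfold replaceInit
  split_ifs
  · exact measurable_pi_apply _
  · exact measurable_const

theorem replaceInit_snoc (r : ℕ) (c : ℕ → ℝ) (x : ℝ) (p : Fin r → ℝ) :
    replaceInit (r + 1) c ((Fin.last r).insertNth x p) =
      replaceInit r (Function.update c r x) p := by
  funext k
  rw [Fin.insertNth_last']
  unfold replaceInit
  rcases lt_trichotomy k r with h | h | h
  · rw [dif_pos (by omega), dif_pos h]
    exact Fin.snoc_castSucc (α := fun _ => ℝ) x p ⟨k, h⟩
  · subst h
    simp only [lt_add_iff_pos_right, zero_lt_one, dif_pos, lt_irrefl, dif_neg, not_false_iff,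
      Function.update_self]
    exact Fin.snoc_last (α := fun _ => ℝ) x p
  · rw [dif_neg (by omega), dif_neg (by omega), Function.update_of_ne (by omega)]

theorem lintegral_fin_succ {r : ℕ} (i : Fin (r + 1)) {G : (Fin (r + 1) → ℝ) → ℝ≥0∞}
    (hG : Measurable G) :
    ∫⁻ q, G q = ∫⁻ x : ℝ, ∫⁻ p : Fin r → ℝ, G (i.insertNth (α := fun _ => ℝ) x p) := by
  have hmp := (volume_preserving_piFinSuccAbove (fun _ : Fin (r + 1) => ℝ) i).symm
  rw [← hmp.lintegral_comp hG, Measure.volume_eq_prod, lintegral_prod]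
  · rfl
  · exact (hG.comp (MeasurableEquiv.measurable _)).aemeasurable

/-- Tonelli with the highest index outermost. As `H k` ignores the entries below `k`, it is a
constant for the inner integrals; where it does not vanish it supplies `P k`, which licenses the
lower bound for the next integral inwards. -/
theorem prod_le_lintegral_prod_replaceInit {H : ℕ → (ℕ → ℝ) → ℝ≥0∞} {a : ℕ → ℝ≥0∞}
    {P : ℕ → (ℕ → ℝ) → Prop} {R : ℕ} (hHm : ∀ k, Measurable (H k))
    (hH : ∀ k b b', (∀ j, k ≤ j → b j = b' j) → H k b = H k b')
    (hP : ∀ k < R, ∀ b, H k b ≠ 0 → P k b)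
    (hstep : ∀ k < R, ∀ b, P (k + 1) b → a k ≤ ∫⁻ x, H k (Function.update b k x)) :
    ∀ r ≤ R, ∀ c, P r c → ∏ k ∈ Finset.range r, a k ≤
      ∫⁻ q : Fin r → ℝ, ∏ k ∈ Finset.range r, H k (replaceInit r c q) := by
  intro r
  induction r with
  | zero => intro _ c _; simp [volume_pi]
  | succ r ih =>
    intro hr c hc
    have hmeas : ∀ r c, Measurable fun q : Fin r → ℝ =>
        ∏ k ∈ Finset.range r, H k (replaceInit r c q) := fun r c =>
      Finset.measurable_fun_prod _ fun k _ => (hHm k).comp (measurable_replaceInit r c)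
    rw [lintegral_fin_succ (Fin.last r) (hmeas _ _)]
    calc ∏ k ∈ Finset.range (r + 1), a k = (∏ k ∈ Finset.range r, a k) * a r :=
          Finset.prod_range_succ _ _
      _ ≤ (∏ k ∈ Finset.range r, a k) * ∫⁻ x, H r (Function.update c r x) := by
          gcongr; exact hstep r (by omega) c hc
      _ ≤ ∫⁻ x, (∏ k ∈ Finset.range r, a k) * H r (Function.update c r x) := by
          rw [lintegral_const_mul]
          exact (hHm r).comp (measurable_update c)
      _ ≤ _ := by
          refine lintegral_mono fun x => ?_
          by_cases h0 : H r (Function.update c r x) = 0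
          · simp [h0]
          have hx := ih (by omega) _ (hP r (by omega) _ h0)
          calc _ ≤ (∫⁻ q : Fin r → ℝ, ∏ k ∈ Finset.range r,
                  H k (replaceInit r (Function.update c r x) q)) * H r (Function.update c r x) := by
                gcongr
            _ = ∫⁻ q : Fin r → ℝ, (∏ k ∈ Finset.range r,
                  H k (replaceInit r (Function.update c r x) q)) * H r (Function.update c r x) :=
                (lintegral_mul_const _ (hmeas _ _)).symm
            _ = _ := by
                refine lintegral_congr fun q => ?_
                rw [Finset.prod_range_succ, replaceInit_snoc]
                congr 1
                refine hH r _ _ fun j hj => ?_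
                simp [replaceInit, not_lt.2 hj]

/-! ### The endpoint map -/

/-- The endpoint `y₀ + ∑_l (b_{2l} - b_{2l+2}) γ(b_{2l+1})` of a path of alternating moves. -/
noncomputable def endpoint {d : ℕ} (γ : ℝ → Fin d → ℝ) (y₀ : Fin d → ℝ) (b : ℕ → ℝ) : Fin d → ℝ :=
  y₀ + ∑ l ∈ Finset.range (d / 2 + 1), (b (2 * l) - b (2 * l + 2)) • γ (b (2 * l + 1))

/-- The sequence `s, p 0, …, p (d - 1), c (d + 1), c (d + 2), …`. -/
def pathSeq {d : ℕ} (c : ℕ → ℝ) (s : ℝ) (p : Fin d → ℝ) : ℕ → ℝ :=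
  replaceInit (d + 1) c ((0 : Fin (d + 1)).insertNth (α := fun _ => ℝ) s p)

section pathSeq

variable {d : ℕ} (c : ℕ → ℝ) (s : ℝ) (p : Fin d → ℝ)

theorem pathSeq_zero : pathSeq c s p 0 = s := by
  simp [pathSeq, replaceInit]

theorem pathSeq_succ (k : Fin d) : pathSeq c s p (k + 1) = p k := by
  have : (k : ℕ) + 1 < d + 1 := by omega
  simp only [pathSeq, replaceInit, dif_pos this, Fin.insertNth_zero']
  exact Fin.cons_succ (α := fun _ => ℝ) s p k

theorem pathSeq_of_lt {k : ℕ} (hk : d < k) : pathSeq c s p k = c k := by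
  simp [pathSeq, replaceInit, show ¬ k < d + 1 by omega]

/-- The derivative of the `k`-th entry of `pathSeq` in `p`. -/
def pathSeqDeriv (d k : ℕ) : (Fin d → ℝ) →L[ℝ] ℝ :=
  if h : 1 ≤ k ∧ k ≤ d then ContinuousLinearMap.proj (⟨k - 1, by omega⟩ : Fin d) else 0

theorem hasFDerivAt_pathSeq (k : ℕ) :
    HasFDerivAt (fun p : Fin d → ℝ => pathSeq c s p k) (pathSeqDeriv d k) p := by
  unfold pathSeqDeriv
  split_ifs with h
  · obtain ⟨j, rfl⟩ : ∃ j : Fin d, k = j + 1 := ⟨⟨k - 1, by omega⟩, by simp; omega⟩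
    simp only [pathSeq_succ, Nat.add_sub_cancel, Fin.eta]
    exact (ContinuousLinearMap.proj (R := ℝ) (φ := fun _ : Fin d => ℝ) j).hasFDerivAt
  · by_cases hk : k = 0
    · subst hk
      simp only [pathSeq_zero]
      exact hasFDerivAt_const _ _
    · simp only [fun p : Fin d → ℝ => pathSeq_of_lt c s p (show d < k by omega)]
      exact hasFDerivAt_const _ _

theorem pathSeqDeriv_single (k : ℕ) (j : Fin d) :
    pathSeqDeriv d k (Pi.single j 1) = if k = j + 1 then 1 else 0 := by
  unfold pathSeqDeriv
  split_ifs with h h' h'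
  · subst h'; simp
  · have : (⟨k - 1, by omega⟩ : Fin d) ≠ j := fun e => h' (by rw [← e]; simp; omega)
    simp [this]
  · omega
  · simp

end pathSeq

/-- The derivative of the endpoint of `pathSeq c s p` in `p`. -/
noncomputable def endpointDeriv {d : ℕ} (γ γ' : ℝ → Fin d → ℝ) (b : ℕ → ℝ) :
    (Fin d → ℝ) →L[ℝ] (Fin d → ℝ) :=
  ∑ l ∈ Finset.range (d / 2 + 1),
    ((b (2 * l) - b (2 * l + 2)) • (pathSeqDeriv d (2 * l + 1)).smulRight (γ' (b (2 * l + 1))) +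
      (pathSeqDeriv d (2 * l) - pathSeqDeriv d (2 * l + 2)).smulRight (γ (b (2 * l + 1))))

/-- The `j`-th parameter is the entry `b (j + 1)`. At an odd index it is the direction of one
segment and differentiates to a velocity times the segment length; at an even index it separates two
consecutive segments and yields the difference of their directions. -/
theorem endpointDeriv_single {d : ℕ} (γ γ' : ℝ → Fin d → ℝ) (b : ℕ → ℝ) (j i : Fin d) :
    endpointDeriv γ γ' b (Pi.single j 1) i =
      (if Even (j : ℕ) then b j - b (j + 2) else -1) * mixedMatrix γ γ' b i j := by
  have hj := j.2
  have e : endpointDeriv γ γ' b (Pi.single j 1) i = ∑ l ∈ Finset.range (d / 2 + 1),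
      ((if (2 * l + 1 : ℕ) = j + 1 then (b (2 * l) - b (2 * l + 2)) * γ' (b (2 * l + 1)) i else 0) +
      ((if (2 * l : ℕ) = j + 1 then γ (b (2 * l + 1)) i else 0) -
        (if (2 * l + 2 : ℕ) = j + 1 then γ (b (2 * l + 1)) i else 0))) := by
    simp only [endpointDeriv, sum_apply, add_apply,
      smul_apply, ContinuousLinearMap.smulRight_apply,
      sub_apply, pathSeqDeriv_single, Finset.sum_apply, Pi.add_apply,
      Pi.smul_apply, smul_eq_mul]
    refine Finset.sum_congr rfl fun l _ => ?_
    split_ifs <;> ring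
  rw [e, Finset.sum_add_distrib, Finset.sum_sub_distrib]
  rcases Nat.even_or_odd' (j : ℕ) with ⟨m, hm | hm⟩
  · have hE : Even (j : ℕ) := ⟨m, by omega⟩
    rw [Finset.sum_eq_single_of_mem m (Finset.mem_range.2 (by omega))
        (fun l _ hl => if_neg (by omega)),
      Finset.sum_eq_zero (fun l _ => if_neg (by omega)),
      Finset.sum_eq_zero (fun l _ => if_neg (by omega)), if_pos (by omega)]
    simp only [mixedMatrix, Matrix.of_apply, if_pos hE]
    simp only [hm]
    ring
  · have hE : ¬ Even (j : ℕ) := Nat.not_even_iff_odd.2 ⟨m, hm⟩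
    rw [Finset.sum_eq_zero (fun l _ => if_neg (by omega)),
      Finset.sum_eq_single_of_mem (m + 1) (Finset.mem_range.2 (by omega))
        (fun l _ hl => if_neg (by omega)),
      Finset.sum_eq_single_of_mem m (Finset.mem_range.2 (by omega))
        (fun l _ hl => if_neg (by omega)), if_pos (by omega), if_pos (by omega)]
    simp only [mixedMatrix, Matrix.of_apply, if_neg hE]
    simp only [hm]
    rw [show 2 * (m + 1) + 1 = 2 * m + 1 + 2 by ring]
    ring

theorem det_endpointDeriv {d : ℕ} (γ γ' : ℝ → Fin d → ℝ) (b : ℕ → ℝ) :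
    |(endpointDeriv γ γ' b).det| =
      (∏ j : Fin d, if Even (j : ℕ) then |b j - b (j + 2)| else 1) *
        |(mixedMatrix γ γ' b).det| := by
  have hM : LinearMap.toMatrix' (endpointDeriv γ γ' b : (Fin d → ℝ) →ₗ[ℝ] (Fin d → ℝ)) =
      Matrix.of fun i j : Fin d =>
        (if Even (j : ℕ) then b j - b (j + 2) else -1) * mixedMatrix γ γ' b i j := by
    ext i j
    rw [LinearMap.toMatrix'_apply]
    simp only [Matrix.of_apply, ContinuousLinearMap.coe_coe]
    rw [← endpointDeriv_single]
  rw [ContinuousLinearMap.det, ← LinearMap.det_toMatrix', hM, Matrix.det_mul_row, abs_mul,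
    Finset.abs_prod]
  congr 1
  refine Finset.prod_congr rfl fun j _ => ?_
  split_ifs <;> simp

/-! ### Injectivity and Jacobian of the endpoint map. -/

namespace MonotoneModel

variable {d : ℕ} {C : ℝ} {I : Set ℝ} {γ γ' : ℝ → Fin d → ℝ} {w : ℝ → ℝ}

theorem hasFDerivAt_endpoint (h : MonotoneModel C I γ γ' w) (c : ℕ → ℝ) (s : ℝ) (y₀ : Fin d → ℝ)
    {p : Fin d → ℝ} (hp : ∀ l ≤ d / 2, pathSeq c s p (2 * l + 1) ∈ I) :
    HasFDerivAt (fun p => endpoint γ y₀ (pathSeq c s p)) (endpointDeriv γ γ' (pathSeq c s p)) p := by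
  refine HasFDerivAt.const_add _ (HasFDerivAt.fun_sum fun l hl => ?_)
  have hI := hp l (by have := Finset.mem_range.1 hl; omega)
  have h1 := (hasFDerivAt_pathSeq c s p (2 * l)).sub (hasFDerivAt_pathSeq c s p (2 * l + 2))
  have h2 : HasFDerivAt (fun p : Fin d → ℝ => γ (pathSeq c s p (2 * l + 1)))
      ((pathSeqDeriv d (2 * l + 1)).smulRight (γ' (pathSeq c s p (2 * l + 1)))) p := by
    have e : (pathSeqDeriv d (2 * l + 1)).smulRight (γ' (pathSeq c s p (2 * l + 1))) =
        (ContinuousLinearMap.toSpanSingleton ℝ (γ' (pathSeq c s p (2 * l + 1)))).comp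
          (pathSeqDeriv d (2 * l + 1)) := by
      ext v i
      simp
    rw [e]
    exact (h.hasDerivAt _ hI).hasFDerivAt.comp p (hasFDerivAt_pathSeq c s p (2 * l + 1))
  exact h1.smul h2

/-- The parity constraints that a path has to satisfy. -/
structure IsPath (d : ℕ) (I : Set ℝ) (w : ℝ → ℝ) (α β : ℝ) (b : ℕ → ℝ) : Prop where
  mem : ∀ l ≤ d / 2, b (2 * l + 1) ∈ I
  gap_even : ∀ l ≤ d / 2, b (2 * l + 2) + α / w (b (2 * l + 1)) ≤ b (2 * l)
  gap_odd : ∀ l < d / 2, b (2 * l + 3) + 4 * (β / w (b (2 * l + 3))) ≤ b (2 * l + 1)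

/-- The displacement is a combination of points of the curve with positive coefficients, whose sum
telescopes to the fixed number `s - c (2 * (d / 2) + 2)`. Hence `eq_of_sum_smul_eq` recovers the
directions and the segment lengths, and the even entries follow one by one from `s`. -/
theorem endpoint_injOn (h : MonotoneModel C I γ γ' w) {α β : ℝ} (hα : 0 < α) (hβ : 0 < β)
    (c : ℕ → ℝ) (s : ℝ) (y₀ : Fin d → ℝ) :
    InjOn (fun p : Fin d → ℝ => endpoint γ y₀ (pathSeq c s p)) {p : Fin d → ℝ | IsPath d I w α β (pathSeq c s p)} := by
  have hpos : ∀ p : Fin d → ℝ, IsPath d I w α β (pathSeq c s p) → ∀ l : Fin (d / 2 + 1),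
      0 < pathSeq c s p (2 * l) - pathSeq c s p (2 * l + 2) := fun p hp l => by
    have h1 := hp.gap_even l (by omega)
    have := div_pos hα (h.weight_pos _ (hp.mem l (by omega)))
    linarith
  have hanti : ∀ p : Fin d → ℝ, IsPath d I w α β (pathSeq c s p) →
      StrictAnti fun l : Fin (d / 2 + 1) => pathSeq c s p (2 * l + 1) := fun p hp => by
    refine Fin.strictAnti_iff_succ_lt.2 fun l => ?_
    have h1 := hp.gap_odd l l.2
    have h2 := div_pos hβ (h.weight_pos _ (hp.mem (l + 1) (by omega)))
    simp only [Fin.val_succ, Fin.val_castSucc]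
    rw [show 2 * ((l : ℕ) + 1) + 1 = 2 * l + 3 by ring] at h2 ⊢
    linarith
  have hsum : ∀ p : Fin d → ℝ, ∑ l : Fin (d / 2 + 1),
      (pathSeq c s p (2 * l) - pathSeq c s p (2 * l + 2)) = s - c (2 * (d / 2) + 2) := fun p => by
    rw [Fin.sum_univ_eq_sum_range (fun l => pathSeq c s p (2 * l) - pathSeq c s p (2 * l + 2))]
    have := Finset.sum_range_sub' (fun l => pathSeq c s p (2 * l)) (d / 2 + 1)
    simp only [mul_add, mul_one, mul_zero] at this
    rw [this, pathSeq_zero, pathSeq_of_lt c s p (by omega)]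
  intro p hp p' hp' he
  obtain ⟨h1, h2⟩ := h.eq_of_sum_smul_eq (hanti p hp) (hanti p' hp') (fun l => hp.mem l (by omega))
    (fun l => hp'.mem l (by omega)) (hpos p hp) (hpos p' hp') (by
      -- For odd `d` the two paths have `d + 1` directions in total. For even `d` there are `d + 2`,
      -- but the direction `c (d + 1)` of the starting line is common to both.
      refine le_trans ?_ (show _ ≤ d + 1 from ?_) (b := if Even d then d / 2 + 1 + (d / 2 + 1) - 1
        else d / 2 + 1 + (d / 2 + 1))
      · have hc1 : ∀ t : Fin (d / 2 + 1) → ℝ, (Finset.univ.image t).card ≤ d / 2 + 1 := fun t =>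
          Finset.card_image_le.trans (by simp)
        have a1 := hc1 fun l => pathSeq c s p (2 * l + 1)
        have a2 := hc1 fun l => pathSeq c s p' (2 * l + 1)
        have a3 := Finset.card_union_add_card_inter
          (Finset.univ.image fun l : Fin (d / 2 + 1) => pathSeq c s p (2 * l + 1))
          (Finset.univ.image fun l : Fin (d / 2 + 1) => pathSeq c s p' (2 * l + 1))
        split_ifs with hd
        · have hlast : ∀ p : Fin d → ℝ, c (d + 1) ∈
              Finset.univ.image fun l : Fin (d / 2 + 1) => pathSeq c s p (2 * l + 1) := fun p => by
            refine Finset.mem_image.2 ⟨Fin.last _, Finset.mem_univ _, ?_⟩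
            obtain ⟨m, hm⟩ := hd
            rw [Fin.val_last, show 2 * (d / 2) + 1 = d + 1 by omega,
              pathSeq_of_lt c s p (Nat.lt_succ_self d)]
          have := Finset.card_pos.2 ⟨_, Finset.mem_inter.2 ⟨hlast p, hlast p'⟩⟩
          omega
        · omega
      · split_ifs with hd
        · omega
        · have := Nat.not_even_iff_odd.1 hd
          obtain ⟨m, hm⟩ := this
          omega)
    ((hsum p).trans (hsum p').symm) (by
      have := add_left_cancel (a := y₀) he
      rwa [← Fin.sum_univ_eq_sum_range (fun l => (pathSeq c s p (2 * l) -
          pathSeq c s p (2 * l + 2)) • γ (pathSeq c s p (2 * l + 1))),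
        ← Fin.sum_univ_eq_sum_range (fun l => (pathSeq c s p' (2 * l) -
          pathSeq c s p' (2 * l + 2)) • γ (pathSeq c s p' (2 * l + 1)))] at this)
  have heven : ∀ l ≤ d / 2 + 1, pathSeq c s p (2 * l) = pathSeq c s p' (2 * l) := by
    intro l
    induction l with
    | zero => intro _; simp [pathSeq_zero]
    | succ l ih =>
      intro hl
      have e1 := ih (by omega)
      have e2 := congrFun h2 ⟨l, by omega⟩
      simp only at e2
      rw [show 2 * (l + 1) = 2 * l + 2 by ring]
      linarith
  funext k
  rw [← pathSeq_succ c s p k, ← pathSeq_succ c s p' k]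
  have hk := k.2
  rcases Nat.even_or_odd' ((k : ℕ) + 1) with ⟨m, hm | hm⟩
  · rw [hm]; exact heven m (by omega)
  · rw [hm]; exact congrFun h1 ⟨m, by omega⟩

/-- The index of the weight that enters the density of the `k`-th move. -/
def weightIndex (k : ℕ) : ℕ := if Even k then k + 1 else k

/-- The weights combine to precisely the density of the moves: an even column gives `w ^ 2` times a
segment length at least `α / w`, an odd column gives `β * w`, and the leftover factor at the
smallest breakpoint is the weight of move `d`. -/
theorem le_abs_det_endpointDeriv (h : MonotoneModel C I γ γ' w) {α β : ℝ} (hα : 0 < α) (hβ : 0 < β)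
    {b : ℕ → ℝ} (hb : IsPath d I w α β b) :
    C * β ^ ((d : ℝ) * (d - 1) / 2) * (∏ k ∈ Finset.range d, if Even k then α else β) *
      ∏ k ∈ Finset.range (d + 1), w (b (weightIndex k)) ≤ |(endpointDeriv γ γ' b).det| := by
  have hC := h.const_pos
  have hmem : ∀ p : ℕ, Odd p → p ≤ d + 1 → b p ∈ I := by
    rintro p ⟨l, rfl⟩ hp; exact hb.mem l (by omega)
  rw [det_endpointDeriv]
  have h1 : ∏ j : Fin d, (if Even (j : ℕ) then α / w (b (j + 1)) else 1) ≤
      ∏ j : Fin d, if Even (j : ℕ) then |b j - b (j + 2)| else 1 := by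
    refine Finset.prod_le_prod (fun j _ => ?_) fun j _ => ?_
    · split_ifs with hj
      · exact (div_pos hα (h.weight_pos _ (hmem _ hj.add_one (by omega)))).le
      · exact zero_le_one
    · split_ifs with hj
      · obtain ⟨l, hl⟩ := even_iff_two_dvd.1 hj
        have := hb.gap_even l (by omega)
        rw [← hl] at this
        exact le_trans (by linarith) (le_abs_self _)
      · exact le_rfl
  have h2 := h.le_abs_det_mixedMatrix hβ hb.mem hb.gap_odd
  refine le_trans (le_of_eq ?_) (mul_le_mul h1 h2 ?_ ?_)
  · have hlast : weightIndex d = 2 * (d / 2) + 1 := by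
      unfold weightIndex
      split_ifs with hd
      · obtain ⟨m, hm⟩ := hd; omega
      · obtain ⟨m, hm⟩ := Nat.not_even_iff_odd.1 hd; omega
    rw [Finset.prod_range_succ, hlast, ← Fin.prod_univ_eq_prod_range
      (fun k => if Even k then α else β), ← Fin.prod_univ_eq_prod_range
      (fun k => w (b (weightIndex k)))]
    have : (∏ k : Fin d, if Even (k : ℕ) then α else β) * ∏ k : Fin d, w (b (weightIndex k)) =
        (∏ j : Fin d, (if Even (j : ℕ) then α / w (b (j + 1)) else 1)) *
        ∏ k : Fin d, if Even (k : ℕ) then w (b (k + 1)) ^ 2 else β * w (b k) := by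
      rw [← Finset.prod_mul_distrib, ← Finset.prod_mul_distrib]
      refine Finset.prod_congr rfl fun k _ => ?_
      unfold weightIndex
      split_ifs with hk
      · have := (h.weight_pos _ (hmem _ hk.add_one (by omega))).ne'
        field_simp
      · ring
    calc _ = C * β ^ ((d : ℝ) * (d - 1) / 2) * ((∏ k : Fin d, if Even (k : ℕ) then α else β) *
          ∏ k : Fin d, w (b (weightIndex k))) * w (b (2 * (d / 2) + 1)) := by ring
      _ = _ := by rw [this]; ring
  · refine mul_nonneg (mul_nonneg (by positivity) (Finset.prod_nonneg fun k _ => ?_))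
      (h.weight_pos _ (hb.mem _ le_rfl)).le
    split_ifs with hk
    · positivity
    · exact mul_nonneg hβ.le
        (h.weight_pos _ (hmem _ (Nat.not_even_iff_odd.1 hk) (by omega))).le
  · exact Finset.prod_nonneg fun k _ => by split_ifs <;> positivity

/-- Area formula for the endpoint map on a set of admissible paths. -/
theorem lintegral_weights_le_volume (h : MonotoneModel C I γ γ' w) {α β : ℝ} (hα : 0 < α)
    (hβ : 0 < β) (c : ℕ → ℝ) (s : ℝ) (y₀ : Fin d → ℝ) {G : Set (Fin d → ℝ)} (hG : MeasurableSet G)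
    (hpath : ∀ p ∈ G, IsPath d I w α β (pathSeq c s p)) {A : Set (Fin d → ℝ)}
    (hA : ∀ p ∈ G, endpoint γ y₀ (pathSeq c s p) ∈ A) :
    ∫⁻ p in G, ENNReal.ofReal (C * β ^ ((d : ℝ) * (d - 1) / 2) *
      (∏ k ∈ Finset.range d, if Even k then α else β) *
        ∏ k ∈ Finset.range (d + 1), w (pathSeq c s p (weightIndex k))) ≤ volume A := by
  calc _ ≤ ∫⁻ p in G, ENNReal.ofReal |(endpointDeriv γ γ' (pathSeq c s p)).det| :=
        setLIntegral_mono_ae' hG (Filter.Eventually.of_forall fun p hp =>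
          ENNReal.ofReal_le_ofReal (h.le_abs_det_endpointDeriv hα hβ (hpath p hp)))
    _ = volume ((fun p => endpoint γ y₀ (pathSeq c s p)) '' G) :=
        lintegral_abs_det_fderiv_eq_addHaar_image volume hG
          (fun p hp => (h.hasFDerivAt_endpoint c s y₀ (hpath p hp).mem).hasFDerivWithinAt)
          ((h.endpoint_injOn hα hβ c s y₀).mono hpath)
    _ ≤ volume A := measure_mono (by rintro _ ⟨p, hp, rfl⟩; exact hA p hp)

end MonotoneModel

/-! ### Flags, moves and refinements -/

section Moves

variable {d : ℕ} (γ : ℝ → Fin d → ℝ) (w : ℝ → ℝ) (α β : ℝ)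

/-- The incident pairs of a point `(s, y) ∈ E` and a line `(t, y - s γ(t)) ∈ F` with `t ∈ I`. -/
def flags (I : Set ℝ) (E F : Set (ℝ × (Fin d → ℝ))) : Set (ℝ × ℝ × (Fin d → ℝ)) :=
  {φ | φ.2.1 ∈ I ∧ (φ.1, φ.2.2) ∈ E ∧ (φ.2.1, φ.2.2 - φ.1 • γ φ.2.1) ∈ F}

/-- Even moves change the point on a line, odd moves change the line through a point. -/
def move (k : ℕ) (φ : ℝ × ℝ × (Fin d → ℝ)) (x : ℝ) : ℝ × ℝ × (Fin d → ℝ) :=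
  if Even k then (x, φ.2.1, φ.2.2 + (x - φ.1) • γ φ.2.1) else (φ.1, x, φ.2.2)

/-- The weight of a move. -/
def moveWeight (k : ℕ) (φ : ℝ × ℝ × (Fin d → ℝ)) (x : ℝ) : ℝ := if Even k then w φ.2.1 else w x

/-- The smallest parameter that is allowed in a move. -/
noncomputable def moveMin (k : ℕ) (φ : ℝ × ℝ × (Fin d → ℝ)) : ℝ :=
  if Even k then φ.1 + α / w φ.2.1 else φ.2.1 + 4 * (β / w φ.2.1)

open Classical in
/-- The density of the allowed moves into `S`. -/
noncomputable def moveDensity (k : ℕ) (S : Set (ℝ × ℝ × (Fin d → ℝ)))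
    (φ : ℝ × ℝ × (Fin d → ℝ)) (x : ℝ) : ℝ≥0∞ :=
  if moveMin w α β k φ ≤ x ∧ move γ k φ x ∈ S then ENNReal.ofReal (moveWeight w k φ x) else 0

/-- The mass of moves that is required in a refinement. -/
noncomputable def moveMass (k : ℕ) : ℝ := if Even k then α else 4 * Real.exp 1 * β

/-- Successive refinements of a set of flags. -/
noncomputable def refined (S : Set (ℝ × ℝ × (Fin d → ℝ))) : ℕ → Set (ℝ × ℝ × (Fin d → ℝ))
  | 0 => S
  | k + 1 => {φ ∈ refined S k | ENNReal.ofReal (moveMass α β k) ≤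
      ∫⁻ x, moveDensity γ w α β k (refined S k) φ x}

/-- The weighted measure on flags. -/
noncomputable def flagMeasure (d : ℕ) (w : ℝ → ℝ) : Measure (ℝ × ℝ × (Fin d → ℝ)) :=
  volume.withDensity fun φ => ENNReal.ofReal (w φ.2.1)

variable {γ w}

theorem measurable_move (hγ : Measurable γ) (k : ℕ) :
    Measurable fun z : (ℝ × ℝ × (Fin d → ℝ)) × ℝ => move γ k z.1 z.2 := by
  unfold move
  split_ifs
  · fun_prop
  · fun_prop

theorem measurable_moveMin (hw : Measurable w) (k : ℕ) :
    Measurable (moveMin (d := d) w α β k) := by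
  unfold moveMin
  split_ifs
  · fun_prop
  · fun_prop

theorem measurable_moveWeight (hw : Measurable w) (k : ℕ) :
    Measurable fun z : (ℝ × ℝ × (Fin d → ℝ)) × ℝ => moveWeight w k z.1 z.2 := by
  unfold moveWeight
  split_ifs
  · fun_prop
  · fun_prop

theorem measurable_moveDensity (hγ : Measurable γ) (hw : Measurable w) (k : ℕ)
    {S : Set (ℝ × ℝ × (Fin d → ℝ))} (hS : MeasurableSet S) :
    Measurable fun z : (ℝ × ℝ × (Fin d → ℝ)) × ℝ => moveDensity γ w α β k S z.1 z.2 := by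
  unfold moveDensity
  refine Measurable.ite ?_ (measurable_moveWeight hw k).ennreal_ofReal measurable_const
  exact (measurableSet_le ((measurable_moveMin α β hw k).comp measurable_fst) measurable_snd).inter
    (measurable_move hγ k hS)

theorem measurableSet_refined (hγ : Measurable γ) (hw : Measurable w)
    {S : Set (ℝ × ℝ × (Fin d → ℝ))} (hS : MeasurableSet S) (k : ℕ) :
    MeasurableSet (refined γ w α β S k) := by
  induction k with
  | zero => exact hS
  | succ k ih =>
    exact ih.inter (measurableSet_le measurable_const
      (measurable_moveDensity α β hγ hw k ih).lintegral_prod_right')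

theorem refined_subset (S : Set (ℝ × ℝ × (Fin d → ℝ))) (k : ℕ) : refined γ w α β S k ⊆ S := by
  induction k with
  | zero => exact subset_rfl
  | succ k ih => exact (sep_subset _ _).trans ih

theorem measurableSet_flags (hγ : Measurable γ) {I : Set ℝ} (hI : MeasurableSet I)
    {E F : Set (ℝ × (Fin d → ℝ))} (hE : MeasurableSet E) (hF : MeasurableSet F) :
    MeasurableSet (flags γ I E F) := by
  have h1 : Measurable fun φ : ℝ × ℝ × (Fin d → ℝ) => φ.2.1 := by fun_prop
  have h2 : Measurable fun φ : ℝ × ℝ × (Fin d → ℝ) => (φ.1, φ.2.2) := by fun_prop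
  have h3 : Measurable fun φ : ℝ × ℝ × (Fin d → ℝ) => (φ.2.1, φ.2.2 - φ.1 • γ φ.2.1) := by
    fun_prop
  exact (h1 hI).inter ((h2 hE).inter (h3 hF))

/-- Integration over flags, fibred over lines. -/
theorem lintegral_eq_lintegral_lines (hγ : Measurable γ) {g : ℝ × ℝ × (Fin d → ℝ) → ℝ≥0∞}
    (hg : Measurable g) :
    ∫⁻ φ, g φ = ∫⁻ z : ℝ × (Fin d → ℝ), ∫⁻ s : ℝ, g (s, z.1, z.2 + s • γ z.1) := by
  rw [Measure.volume_eq_prod, lintegral_prod _ hg.aemeasurable]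
  have hm : Measurable fun u : ℝ × ℝ × (Fin d → ℝ) => g (u.1, u.2.1, u.2.2 + u.1 • γ u.2.1) :=
    hg.comp (by fun_prop)
  rw [← lintegral_lintegral_swap (f := fun (s : ℝ) (z : ℝ × (Fin d → ℝ)) =>
    g (s, z.1, z.2 + s • γ z.1)) hm.aemeasurable]
  refine lintegral_congr fun s => ?_
  have h1 : Measurable fun z : ℝ × (Fin d → ℝ) => g (s, z) := hg.comp (by fun_prop)
  have h2 : Measurable fun z : ℝ × (Fin d → ℝ) => g (s, z.1, z.2 + s • γ z.1) :=
    hg.comp (by fun_prop)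
  rw [Measure.volume_eq_prod, lintegral_prod _ h1.aemeasurable, lintegral_prod _ h2.aemeasurable]
  refine lintegral_congr fun t => ?_
  exact (lintegral_add_right_eq_self (fun y => g (s, t, y)) (s • γ t)).symm

/-- Integration over flags, fibred over points. -/
theorem lintegral_eq_lintegral_points {g : ℝ × ℝ × (Fin d → ℝ) → ℝ≥0∞} (hg : Measurable g) :
    ∫⁻ φ, g φ = ∫⁻ z : ℝ × (Fin d → ℝ), ∫⁻ t : ℝ, g (z.1, t, z.2) := by
  have hm : Measurable fun u : (ℝ × (Fin d → ℝ)) × ℝ => g (u.1.1, u.2, u.1.2) :=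
    hg.comp (by fun_prop)
  rw [Measure.volume_eq_prod, lintegral_prod _ hg.aemeasurable, Measure.volume_eq_prod ℝ (Fin d → ℝ),
    lintegral_prod _ hm.lintegral_prod_right'.aemeasurable]
  refine lintegral_congr fun s => ?_
  have h1 : Measurable fun z : ℝ × (Fin d → ℝ) => g (s, z) := hg.comp (by fun_prop)
  rw [lintegral_prod _ h1.aemeasurable]
  exact lintegral_lintegral_swap (f := fun t y => g (s, t, y)) (hg.comp (by fun_prop)).aemeasurable

theorem flagMeasure_apply {S : Set (ℝ × ℝ × (Fin d → ℝ))} (hS : MeasurableSet S) :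
    flagMeasure d w S = ∫⁻ φ, S.indicator (fun φ => ENNReal.ofReal (w φ.2.1)) φ := by
  rw [flagMeasure, withDensity_apply _ hS, lintegral_indicator hS]

theorem measurable_indicator_weight (hw : Measurable w) {S : Set (ℝ × ℝ × (Fin d → ℝ))}
    (hS : MeasurableSet S) :
    Measurable (S.indicator fun φ : ℝ × ℝ × (Fin d → ℝ) => ENNReal.ofReal (w φ.2.1)) :=
  Measurable.indicator (by fun_prop) hS

/-- The degenerate case is separated because `α` and `β` will be quotients by the two volumes. -/
theorem flagMeasure_flags_eq_zero (hγ : Measurable γ) (hw : Measurable w) {I : Set ℝ}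
    (hI : MeasurableSet I) {E F : Set (ℝ × (Fin d → ℝ))} (hE : MeasurableSet E)
    (hF : MeasurableSet F) (h0 : volume E = 0 ∨ volume F = 0) :
    flagMeasure d w (flags γ I E F) = 0 := by
  have hS := measurableSet_flags hγ hI hE hF
  have hm := measurable_indicator_weight hw hS
  rw [flagMeasure_apply hS]
  rcases h0 with h0 | h0
  · rw [lintegral_eq_lintegral_points hm, ← nonpos_iff_eq_zero]
    calc _ ≤ ∫⁻ z, E.indicator (fun _ => ∞) z := by
          refine lintegral_mono fun z => ?_
          by_cases hz : z ∈ E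
          · simp [hz]
          · rw [indicator_of_notMem hz]
            refine le_of_eq (lintegral_eq_zero_of_ae_eq_zero (Filter.Eventually.of_forall fun t => ?_))
            exact indicator_of_notMem (fun h => hz h.2.1) _
      _ = 0 := by rw [lintegral_indicator hE, setLIntegral_const, h0, mul_zero]
  · rw [lintegral_eq_lintegral_lines hγ hm, ← nonpos_iff_eq_zero]
    calc _ ≤ ∫⁻ z, F.indicator (fun _ => ∞) z := by
          refine lintegral_mono fun z => ?_
          by_cases hz : z ∈ F
          · simp [hz]
          · rw [indicator_of_notMem hz]
            refine le_of_eq (lintegral_eq_zero_of_ae_eq_zero (Filter.Eventually.of_forall fun t => ?_))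
            exact indicator_of_notMem (fun h => hz (by simpa using h.2.2)) _
      _ = 0 := by rw [lintegral_indicator hF, setLIntegral_const, h0, mul_zero]

end Moves

/-! ### Mass lost in a refinement. -/

namespace MonotoneModel

variable {d : ℕ} {C : ℝ} {I : Set ℝ} {γ γ' : ℝ → Fin d → ℝ} {w : ℝ → ℝ}
  {E F : Set (ℝ × (Fin d → ℝ))} {S : Set (ℝ × ℝ × (Fin d → ℝ))} {α β : ℝ}

/-- On a single line the weight `w t` is constant, so the condition is one on Lebesgue measure with
threshold `α / w t`. A set of length at most `2 * (α / w t)` is lost, of weighted mass `2 * α`, for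
each line in `F`. -/
theorem flagMeasure_loss_even (h : MonotoneModel C I γ γ' w) (hF : MeasurableSet F)
    (hS : MeasurableSet S) (hSF : S ⊆ flags γ I E F) (hα : 0 < α) {k : ℕ} (hk : Even k) :
    flagMeasure d w {φ ∈ S | ¬ ENNReal.ofReal (moveMass α β k) ≤
      ∫⁻ x, moveDensity γ w α β k S φ x} ≤ ENNReal.ofReal (2 * α) * volume F := by
  have hA : MeasurableSet {φ ∈ S | ¬ ENNReal.ofReal (moveMass α β k) ≤
      ∫⁻ x, moveDensity γ w α β k S φ x} := hS.inter (measurableSet_le measurable_const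
        (measurable_moveDensity α β h.measurable_curve h.measurable_weight k
          hS).lintegral_prod_right').compl
  set A := {φ ∈ S | ¬ ENNReal.ofReal (moveMass α β k) ≤ ∫⁻ x, moveDensity γ w α β k S φ x} with hAdef
  rw [flagMeasure_apply hA, lintegral_eq_lintegral_lines h.measurable_curve
    (measurable_indicator_weight h.measurable_weight hA), ← setLIntegral_const,
    ← lintegral_indicator hF]
  refine lintegral_mono fun z => ?_
  obtain ⟨t, x⟩ := z
  by_cases hz : (t, x) ∈ F ∧ t ∈ I
  swap
  · refine le_trans (le_of_eq (lintegral_eq_zero_of_ae_eq_zero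
      (Filter.Eventually.of_forall fun s => ?_))) zero_le
    refine indicator_of_notMem (fun hs => hz ?_) _
    have := hSF hs.1
    exact ⟨by simpa using this.2.2, this.1⟩
  rw [indicator_of_mem hz.1]
  have hw := h.weight_pos t hz.2
  set T : Set ℝ := {s | (s, t, x + s • γ t) ∈ S} with hT
  have hTm : MeasurableSet T := by
    have : Measurable fun s : ℝ => (s, t, x + s • γ t) := by fun_prop
    exact this hS
  have hAm : MeasurableSet {s : ℝ | (s, t, x + s • γ t) ∈ A} := by
    have : Measurable fun s : ℝ => (s, t, x + s • γ t) := by fun_prop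
    exact this hA
  have hsub : {s : ℝ | (s, t, x + s • γ t) ∈ A} ⊆
      {s ∈ T | volume (T ∩ Ici (s + α / w t)) < ENNReal.ofReal (α / w t)} := by
    rintro s ⟨hs1, hs2⟩
    refine ⟨hs1, ?_⟩
    have e : ∀ r, moveDensity γ w α β k S (s, t, x + s • γ t) r =
        (T ∩ Ici (s + α / w t)).indicator (fun _ => ENNReal.ofReal (w t)) r := fun r => by
      have em : move γ k (s, t, x + s • γ t) r = (r, t, x + r • γ t) := by
        simp only [move, if_pos hk]
        congr 2
        rw [sub_smul]; abel
      have em' : moveMin w α β k (s, t, x + s • γ t) = s + α / w t := if_pos hk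
      by_cases hr : r ∈ T ∩ Ici (s + α / w t)
      · rw [indicator_of_mem hr, moveDensity, em, em', if_pos ⟨hr.2, hr.1⟩, moveWeight, if_pos hk]
      · rw [indicator_of_notMem hr, moveDensity, em, em', if_neg fun hc => hr ⟨hc.2, hc.1⟩]
    simp only [e, moveMass, if_pos hk, not_le] at hs2
    rw [lintegral_indicator (hTm.inter measurableSet_Ici), setLIntegral_const] at hs2
    rw [ENNReal.ofReal_div_of_pos hw, ENNReal.lt_div_iff_mul_lt (Or.inl (by simpa using hw))
      (Or.inl ENNReal.ofReal_ne_top), mul_comm]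
    exact hs2
  calc ∫⁻ s, A.indicator (fun φ => ENNReal.ofReal (w φ.2.1)) (s, t, x + s • γ t)
      = ∫⁻ s, {s : ℝ | (s, t, x + s • γ t) ∈ A}.indicator (fun _ => ENNReal.ofReal (w t)) s := rfl
    _ = ENNReal.ofReal (w t) * volume {s : ℝ | (s, t, x + s • γ t) ∈ A} := by
        rw [lintegral_indicator hAm, setLIntegral_const]
    _ ≤ ENNReal.ofReal (w t) * ENNReal.ofReal (2 * (α / w t)) := by
        gcongr
        exact (measure_mono hsub).trans (volume_setOf_inter_Ici_add_lt T (div_pos hα hw).le)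
    _ = ENNReal.ofReal (2 * α) := by
        rw [← ENNReal.ofReal_mul hw.le]; congr 1; field_simp

/-- The fibre over a point of `E` carries the log-concave density `w`, so the window estimate with
`b = 4 * exp 1 * β` bounds the loss there by `3 * b`. -/
theorem flagMeasure_loss_odd (h : MonotoneModel C I γ γ' w) (hE : MeasurableSet E)
    (hS : MeasurableSet S) (hSF : S ⊆ flags γ I E F) (hβ : 0 < β) {k : ℕ} (hk : ¬ Even k) :
    flagMeasure d w {φ ∈ S | ¬ ENNReal.ofReal (moveMass α β k) ≤
      ∫⁻ x, moveDensity γ w α β k S φ x} ≤ ENNReal.ofReal (12 * Real.exp 1 * β) * volume E := by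
  have hA : MeasurableSet {φ ∈ S | ¬ ENNReal.ofReal (moveMass α β k) ≤
      ∫⁻ x, moveDensity γ w α β k S φ x} := hS.inter (measurableSet_le measurable_const
        (measurable_moveDensity α β h.measurable_curve h.measurable_weight k
          hS).lintegral_prod_right').compl
  set A := {φ ∈ S | ¬ ENNReal.ofReal (moveMass α β k) ≤ ∫⁻ x, moveDensity γ w α β k S φ x} with hAdef
  rw [flagMeasure_apply hA, lintegral_eq_lintegral_points
    (measurable_indicator_weight h.measurable_weight hA), ← setLIntegral_const,
    ← lintegral_indicator hE]
  refine lintegral_mono fun z => ?_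
  obtain ⟨s, y⟩ := z
  by_cases hz : (s, y) ∈ E
  swap
  · refine le_trans (le_of_eq (lintegral_eq_zero_of_ae_eq_zero
      (Filter.Eventually.of_forall fun t => ?_))) zero_le
    exact indicator_of_notMem (fun hs => hz (hSF hs.1).2.1) _
  rw [indicator_of_mem hz]
  have hwm := h.measurable_weight
  have hIm := h.isOpen.measurableSet
  have hms : Measurable fun t : ℝ => (s, t, y) := by fun_prop
  set T : Set ℝ := {t | (s, t, y) ∈ S} with hT
  have hTm : MeasurableSet T := hms hS
  have hTI : T ⊆ I := fun t ht => (hSF ht).1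
  have hAm : MeasurableSet {t : ℝ | (s, t, y) ∈ A} := hms hA
  set ν : Measure ℝ := (volume.restrict I).withDensity fun t => ENNReal.ofReal (w t) with hν
  have hνapp : ∀ B, MeasurableSet B → B ⊆ I → ν B =
      ∫⁻ t, B.indicator (fun t => ENNReal.ofReal (w t)) t := fun B hB hBI => by
    rw [hν, withDensity_apply _ hB, Measure.restrict_restrict hB, inter_eq_left.2 hBI,
      lintegral_indicator hB]
  have hb : 0 < 4 * Real.exp 1 * β := by have := Real.exp_pos 1; positivity
  have hsub : {t : ℝ | (s, t, y) ∈ A} ⊆ {t ∈ T | ν (T ∩ Ici (t + 4 * Real.exp 1 * β /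
      (Real.exp 1 * w t))) < ENNReal.ofReal (4 * Real.exp 1 * β)} := by
    rintro t ⟨ht1, ht2⟩
    refine ⟨ht1, ?_⟩
    -- This explains the factor `4 * exp 1` in `moveMass`: the window for that mass is exactly the
    -- minimal turn `4 * (β / w t)`.
    have e0 : 4 * Real.exp 1 * β / (Real.exp 1 * w t) = 4 * (β / w t) := by
      have := Real.exp_pos 1
      have := h.weight_pos t (hTI ht1)
      field_simp
    have e : ∀ r, moveDensity γ w α β k S (s, t, y) r =
        (T ∩ Ici (t + 4 * (β / w t))).indicator (fun r => ENNReal.ofReal (w r)) r := fun r => by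
      have em : move γ k (s, t, y) r = (s, r, y) := if_neg hk
      have em' : moveMin w α β k (s, t, y) = t + 4 * (β / w t) := if_neg hk
      by_cases hr : r ∈ T ∩ Ici (t + 4 * (β / w t))
      · rw [indicator_of_mem hr, moveDensity, em, em', if_pos ⟨hr.2, hr.1⟩, moveWeight, if_neg hk]
      · rw [indicator_of_notMem hr, moveDensity, em, em', if_neg fun hc => hr ⟨hc.2, hc.1⟩]
    rw [e0, hνapp _ (hTm.inter measurableSet_Ici) (inter_subset_left.trans hTI)]
    simpa only [e, moveMass, if_neg hk, not_le] using ht2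
  calc ∫⁻ t, A.indicator (fun φ => ENNReal.ofReal (w φ.2.1)) (s, t, y)
      = ∫⁻ t, {t : ℝ | (s, t, y) ∈ A}.indicator (fun t => ENNReal.ofReal (w t)) t := rfl
    _ = ν {t : ℝ | (s, t, y) ∈ A} := (hνapp _ hAm fun t ht => hTI ht.1).symm
    _ ≤ ENNReal.ofReal (3 * (4 * Real.exp 1 * β)) :=
        (measure_mono hsub).trans (measure_setOf_inter_Ici_window_lt h.ordConnected hIm
          h.weight_pos h.logConcave hb hTI hν)
    _ = ENNReal.ofReal (12 * Real.exp 1 * β) := by congr 1; ring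

/-- A set of flags with large measure survives all refinements. -/
theorem refined_nonempty (h : MonotoneModel C I γ γ' w) (hE : MeasurableSet E)
    (hF : MeasurableSet F) (hα : 0 < α) (hβ : 0 < β) {η : ℝ≥0∞}
    (hηF : ENNReal.ofReal (2 * α) * volume F ≤ η)
    (hηE : ENNReal.ofReal (12 * Real.exp 1 * β) * volume E ≤ η) (n : ℕ)
    (hn : n * η < flagMeasure d w (flags γ I E F)) :
    (refined γ w α β (flags γ I E F) n).Nonempty := by
  have hm := measurableSet_flags h.measurable_curve h.isOpen.measurableSet hE hF
  have key : ∀ k : ℕ, flagMeasure d w (flags γ I E F) ≤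
      flagMeasure d w (refined γ w α β (flags γ I E F) k) + k * η := by
    intro k
    induction k with
    | zero => simp [refined]
    | succ k ih =>
      have hmk := measurableSet_refined α β h.measurable_curve h.measurable_weight hm k
      have hsub := refined_subset (γ := γ) (w := w) α β (flags γ I E F) k
      have hloss : flagMeasure d w {φ ∈ refined γ w α β (flags γ I E F) k |
          ¬ ENNReal.ofReal (moveMass α β k) ≤
            ∫⁻ x, moveDensity γ w α β k (refined γ w α β (flags γ I E F) k) φ x} ≤ η := by
        by_cases hk : Even k
        · exact (h.flagMeasure_loss_even hF hmk hsub hα hk).trans hηF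
        · exact (h.flagMeasure_loss_odd hE hmk hsub hβ hk).trans hηE
      refine ih.trans ?_
      calc _ ≤ (flagMeasure d w (refined γ w α β (flags γ I E F) (k + 1)) + η) + k * η := by
            gcongr
            refine (measure_mono ?_).trans ((measure_union_le _ _).trans (add_le_add_right hloss _))
            intro φ hφ
            by_cases hc : ENNReal.ofReal (moveMass α β k) ≤
                ∫⁻ x, moveDensity γ w α β k (refined γ w α β (flags γ I E F) k) φ x
            · exact Or.inl ⟨hφ, hc⟩
            · exact Or.inr ⟨hφ, hc⟩
        _ = _ := by push_cast; ring
  by_contra hne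
  rw [not_nonempty_iff_eq_empty] at hne
  have := key n
  rw [hne, measure_empty, zero_add] at this
  exact absurd hn (not_lt.2 this)

end MonotoneModel

/-! ### Paths through refined flags -/

section PathFlag

variable {d : ℕ} (γ : ℝ → Fin d → ℝ) (y₀ : Fin d → ℝ)

/-- The point reached by a path before the moves `k - 1, …, 0`. -/
noncomputable def pathPoint (k : ℕ) (b : ℕ → ℝ) : Fin d → ℝ :=
  y₀ + ∑ l ∈ Finset.range (d / 2 + 1),
    if k ≤ 2 * l then (b (2 * l) - b (2 * l + 2)) • γ (b (2 * l + 1)) else 0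

/-- The flag reached by a path before the moves `k - 1, …, 0`. -/
noncomputable def pathFlag (k : ℕ) (b : ℕ → ℝ) : ℝ × ℝ × (Fin d → ℝ) :=
  (if Even k then b k else b (k + 1), if Even k then b (k + 1) else b k, pathPoint γ y₀ k b)

theorem pathFlag_congr {k : ℕ} {b b' : ℕ → ℝ} (hb : ∀ j, k ≤ j → b j = b' j) :
    pathFlag γ y₀ k b = pathFlag γ y₀ k b' := by
  unfold pathFlag pathPoint
  rw [hb k le_rfl, hb (k + 1) (by omega)]
  congr 3
  refine Finset.sum_congr rfl fun l _ => ?_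
  split_ifs with hl
  · rw [hb _ hl, hb (2 * l + 2) (by omega), hb (2 * l + 1) (by omega)]
  · rfl

theorem pathFlag_eq_move {k : ℕ} (hk : k ≤ d) (b : ℕ → ℝ) :
    pathFlag γ y₀ k b = move γ k (pathFlag γ y₀ (k + 1) b) (b k) := by
  by_cases hE : Even k
  · have hE' : ¬ Even (k + 1) := Nat.not_even_iff_odd.2 hE.add_one
    obtain ⟨m, hm⟩ := even_iff_two_dvd.1 hE
    simp only [pathFlag, move, if_pos hE, if_neg hE']
    have hsum : ∀ l ∈ Finset.range (d / 2 + 1),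
        (if k ≤ 2 * l then (b (2 * l) - b (2 * l + 2)) • γ (b (2 * l + 1)) else 0) =
        (if k + 1 ≤ 2 * l then (b (2 * l) - b (2 * l + 2)) • γ (b (2 * l + 1)) else 0) +
        (if l = m then (b (2 * l) - b (2 * l + 2)) • γ (b (2 * l + 1)) else 0) := fun l _ => by
      by_cases hlm : l = m
      · subst hlm; simp [hm]
      · by_cases hl : k + 1 ≤ 2 * l
        · rw [if_pos (by omega), if_pos hl, if_neg hlm, add_zero]
        · rw [if_neg (by omega), if_neg hl, if_neg hlm, add_zero]
    have hp : pathPoint γ y₀ k b = pathPoint γ y₀ (k + 1) b + (b k - b (k + 1 + 1)) • γ (b (k + 1)) := by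
      unfold pathPoint
      rw [Finset.sum_congr rfl hsum, Finset.sum_add_distrib, Finset.sum_ite_eq' _ m,
        if_pos (Finset.mem_range.2 (by omega)), add_assoc, hm]
    rw [hp]
  · have hE' : Even (k + 1) := (Nat.not_even_iff_odd.1 hE).add_one
    simp only [pathFlag, move, if_neg hE, if_pos hE']
    have hp : pathPoint γ y₀ k b = pathPoint γ y₀ (k + 1) b := by
      unfold pathPoint
      congr 1
      refine Finset.sum_congr rfl fun l _ => ?_
      obtain ⟨m, hm⟩ := Nat.not_even_iff_odd.1 hE
      by_cases hl : k ≤ 2 * l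
      · rw [if_pos hl, if_pos (by omega)]
      · rw [if_neg hl, if_neg (by omega)]
    rw [hp]

theorem pathPoint_zero (b : ℕ → ℝ) : pathPoint γ y₀ 0 b = endpoint γ y₀ b := by
  simp [pathPoint, endpoint]

theorem pathPoint_of_lt {k : ℕ} (hk : d < k) (b : ℕ → ℝ) : pathPoint γ y₀ k b = y₀ := by
  unfold pathPoint
  rw [Finset.sum_eq_zero, add_zero]
  intro l hl
  exact if_neg (by have := Finset.mem_range.1 hl; omega)

variable {γ}

theorem measurable_pathFlag (hγ : Measurable γ) (k : ℕ) : Measurable (pathFlag γ y₀ k) := by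
  unfold pathFlag pathPoint
  refine Measurable.prodMk ?_ (Measurable.prodMk ?_ ?_)
  · split_ifs <;> fun_prop
  · split_ifs <;> fun_prop
  · refine Measurable.const_add (Finset.measurable_fun_sum _ fun l _ => ?_) _
    split_ifs
    · fun_prop
    · exact measurable_const

end PathFlag

theorem measurable_pathSeq {d : ℕ} (c : ℕ → ℝ) :
    Measurable fun z : ℝ × (Fin d → ℝ) => pathSeq c z.1 z.2 := by
  refine (measurable_replaceInit (d + 1) c).comp ?_
  exact (MeasurableEquiv.piFinSuccAbove (fun _ : Fin (d + 1) => ℝ) 0).symm.measurable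

/-! ### Lower bound for the volume of `E` by integration over paths. -/

namespace MonotoneModel

variable {d : ℕ} {C : ℝ} {I : Set ℝ} {γ γ' : ℝ → Fin d → ℝ} {w : ℝ → ℝ}
  {E F : Set (ℝ × (Fin d → ℝ))} {α β : ℝ}

/-- If some flag survives `d + 1` refinements, then `E` is large. -/
theorem le_volume_of_refined_nonempty (h : MonotoneModel C I γ γ' w) (hE : MeasurableSet E)
    (hF : MeasurableSet F) (hα : 0 < α) (hβ : 0 < β)
    (hne : (refined γ w α β (flags γ I E F) (d + 1)).Nonempty) :
    ENNReal.ofReal (C * β ^ ((d : ℝ) * (d - 1) / 2) *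
      (∏ k ∈ Finset.range d, if Even k then α else β)) *
        ∏ k ∈ Finset.range (d + 1), ENNReal.ofReal (moveMass α β k) ≤ volume E := by
  obtain ⟨φ₀, hφ₀⟩ := hne
  have hγ := h.measurable_curve
  have hw := h.measurable_weight
  set S : ℕ → Set (ℝ × ℝ × (Fin d → ℝ)) := refined γ w α β (flags γ I E F) with hS
  have hSm : ∀ k, MeasurableSet (S k) := measurableSet_refined α β hγ hw
    (measurableSet_flags hγ h.isOpen.measurableSet hE hF)
  have hSf : ∀ k, S k ⊆ flags γ I E F := refined_subset α β (flags γ I E F)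
  -- Only the entries `d + 1` and `d + 2` matter; they encode the starting flag for either parity of
  -- `d`.
  set c : ℕ → ℝ := fun k => if Even k then φ₀.1 else φ₀.2.1 with hc
  set y₀ := φ₀.2.2 with hy₀
  set H : ℕ → (ℕ → ℝ) → ℝ≥0∞ := fun k b =>
    moveDensity γ w α β k (S k) (pathFlag γ y₀ (k + 1) b) (b k) with hH
  have hHm : ∀ k, Measurable (H k) := fun k =>
    (measurable_moveDensity α β hγ hw k (hSm k)).comp
      ((measurable_pathFlag y₀ hγ (k + 1)).prodMk (measurable_pi_apply k))
  have hHne : ∀ k < d + 1, ∀ b, H k b ≠ 0 →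
      moveMin w α β k (pathFlag γ y₀ (k + 1) b) ≤ b k ∧ pathFlag γ y₀ k b ∈ S k ∧
        H k b = ENNReal.ofReal (w (b (weightIndex k))) := by
    intro k hk b hb
    have hcond : moveMin w α β k (pathFlag γ y₀ (k + 1) b) ≤ b k ∧
        move γ k (pathFlag γ y₀ (k + 1) b) (b k) ∈ S k := by
      by_contra hcon
      exact hb (if_neg hcon)
    refine ⟨hcond.1, by rw [pathFlag_eq_move γ y₀ (by omega)]; exact hcond.2, ?_⟩
    have : H k b = ENNReal.ofReal (moveWeight w k (pathFlag γ y₀ (k + 1) b) (b k)) := if_pos hcond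
    rw [this, moveWeight, weightIndex]
    split_ifs with hE
    · simp [pathFlag, Nat.not_even_iff_odd.2 hE.add_one]
    · rfl
  have htower := prod_le_lintegral_prod_replaceInit (H := H)
    (a := fun k => ENNReal.ofReal (moveMass α β k)) (P := fun k b => pathFlag γ y₀ k b ∈ S k)
    (R := d + 1) hHm
    (fun k b b' hb => by
      simp only [hH]
      rw [pathFlag_congr γ y₀ (fun j hj => hb j (by omega)), hb k le_rfl])
    (fun k hk b hb => (hHne k hk b hb).2.1)
    (fun k hk b hb => by
      refine hb.2.trans (le_of_eq (lintegral_congr fun x => ?_))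
      simp only [hH, Function.update_self]
      rw [pathFlag_congr γ y₀ (b := Function.update b k x) (b' := b) fun j hj =>
        Function.update_of_ne (show j ≠ k by omega) _ _])
    (d + 1) le_rfl c (by
      have : pathFlag γ y₀ (d + 1) c = φ₀ := by
        unfold pathFlag
        rw [pathPoint_of_lt γ y₀ (Nat.lt_succ_self d)]
        by_cases hd : Even (d + 1)
        · have hd' : ¬ Even (d + 1 + 1) := Nat.not_even_iff_odd.2 hd.add_one
          simp only [hc, if_pos hd, if_neg hd', hy₀]
        · have hd' : Even (d + 1 + 1) := (Nat.not_even_iff_odd.1 hd).add_one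
          simp only [hc, if_neg hd, if_pos hd', hy₀]
      rw [this]; exact hφ₀)
  have hprodm : Measurable fun b : ℕ → ℝ => ∏ k ∈ Finset.range (d + 1), H k b :=
    Finset.measurable_fun_prod _ fun k _ => hHm k
  -- Entry `0` is the `s`-coordinate of the final point. With it fixed, the remaining `d` parameters
  -- map into a `d`-dimensional slice of `E`.
  rw [lintegral_fin_succ (G := fun q => ∏ k ∈ Finset.range (d + 1), H k (replaceInit (d + 1) c q)) 0
    (hprodm.comp (measurable_replaceInit (d + 1) c))] at htower
  set κ := C * β ^ ((d : ℝ) * (d - 1) / 2) * (∏ k ∈ Finset.range d, if Even k then α else β) with hκ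
  have hκ0 : 0 ≤ κ := by
    have := h.const_pos
    refine mul_nonneg (by positivity) (Finset.prod_nonneg fun k _ => ?_)
    split_ifs <;> positivity
  have hslice : ∀ s : ℝ, ENNReal.ofReal κ * ∫⁻ p : Fin d → ℝ,
      ∏ k ∈ Finset.range (d + 1), H k (pathSeq c s p) ≤ volume (Prod.mk s ⁻¹' E) := by
    intro s
    have hsm : Measurable fun p : Fin d → ℝ => ∏ k ∈ Finset.range (d + 1), H k (pathSeq c s p) :=
      hprodm.comp ((measurable_pathSeq c).comp measurable_prodMk_left)
    -- Where no density vanishes, every move is allowed and lands in its refined set, so the path is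
    -- admissible and ends in `E`.
    set G : Set (Fin d → ℝ) := {p | ∏ k ∈ Finset.range (d + 1), H k (pathSeq c s p) ≠ 0} with hG
    have hGm : MeasurableSet G := hsm (measurableSet_singleton 0).compl
    have hGk : ∀ p ∈ G, ∀ k < d + 1, H k (pathSeq c s p) ≠ 0 := fun p hp k hk =>
      Finset.prod_ne_zero_iff.1 hp k (Finset.mem_range.2 hk)
    have hmem : ∀ p ∈ G, ∀ l ≤ d / 2, pathSeq c s p (2 * l + 1) ∈ I := fun p hp l hl => by
      have := (hSf _ (hHne (2 * l) (by omega) _ (hGk p hp (2 * l) (by omega))).2.1).1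
      simpa [pathFlag] using this
    have hpath : ∀ p ∈ G, IsPath d I w α β (pathSeq c s p) := fun p hp => by
      refine ⟨hmem p hp, fun l hl => ?_, fun l hl => ?_⟩
      · have := (hHne (2 * l) (by omega) _ (hGk p hp (2 * l) (by omega))).1
        have hE1 : Even (2 * l) := even_two_mul l
        have hE2 : ¬ Even (2 * l + 1) := Nat.not_even_iff_odd.2 hE1.add_one
        simpa only [moveMin, pathFlag, if_pos hE1, if_neg hE2] using this
      · have := (hHne (2 * l + 1) (by omega) _ (hGk p hp (2 * l + 1) (by omega))).1
        have hE1 : ¬ Even (2 * l + 1) := Nat.not_even_iff_odd.2 (even_two_mul l).add_one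
        have hE2 : Even (2 * l + 1 + 1) := by rw [show 2 * l + 1 + 1 = 2 * (l + 1) by ring]; simp
        simpa only [moveMin, pathFlag, if_neg hE1, if_pos hE2] using this
    have hend : ∀ p ∈ G, endpoint γ y₀ (pathSeq c s p) ∈ Prod.mk s ⁻¹' E := fun p hp => by
      have := (hSf _ (hHne 0 (by omega) _ (hGk p hp 0 (by omega))).2.1).2.1
      simpa [pathFlag, pathPoint_zero, pathSeq_zero] using this
    refine le_trans ?_ (h.lintegral_weights_le_volume hα hβ c s y₀ hGm hpath hend)
    rw [← lintegral_const_mul _ hsm, ← lintegral_indicator hGm]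
    refine lintegral_mono fun p => ?_
    by_cases hp : p ∈ G
    · rw [indicator_of_mem hp, ENNReal.ofReal_mul hκ0, ENNReal.ofReal_prod_of_nonneg]
      · refine le_of_eq (congrArg _ (Finset.prod_congr rfl fun k hk => ?_))
        have hk' := Finset.mem_range.1 hk
        exact (hHne k hk' _ (hGk p hp k hk')).2.2
      · intro k hk
        have hk' := Finset.mem_range.1 hk
        by_contra! hneg
        exact hGk p hp k hk' (by
          rw [(hHne k hk' _ (hGk p hp k hk')).2.2]; exact ENNReal.ofReal_of_nonpos hneg.le)
    · have : ∏ k ∈ Finset.range (d + 1), H k (pathSeq c s p) = 0 := not_not.1 hp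
      simp only [this, mul_zero, zero_le]
  calc _ ≤ ENNReal.ofReal κ * ∫⁻ s : ℝ, ∫⁻ p : Fin d → ℝ,
        ∏ k ∈ Finset.range (d + 1), H k (pathSeq c s p) := by
        gcongr
        exact htower
    _ = ∫⁻ s : ℝ, ENNReal.ofReal κ * ∫⁻ p : Fin d → ℝ,
        ∏ k ∈ Finset.range (d + 1), H k (pathSeq c s p) := by
        rw [lintegral_const_mul]
        exact (hprodm.comp (measurable_pathSeq c)).lintegral_prod_right'
    _ ≤ ∫⁻ s : ℝ, volume (Prod.mk s ⁻¹' E) := lintegral_mono hslice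
    _ = volume E := by rw [Measure.volume_eq_prod, Measure.prod_apply hE]

/-! ### Choice of the thresholds and count of the exponents. -/

theorem prod_range_parity (α β : ℝ) (d : ℕ) :
    (∏ k ∈ Finset.range d, if Even k then α else β) *
      (∏ k ∈ Finset.range (d + 1), if Even k then α else β) = α * (α * β) ^ d := by
  -- Factor `k` of the first product is matched with factor `k + 1` of the second; opposite parities
  -- give `α * β`.
  rw [Finset.prod_range_succ', mul_comm _ (if Even 0 then α else β), mul_left_comm,
    ← Finset.prod_mul_distrib, if_pos (by simp : Even 0)]
  congr 1
  rw [Finset.prod_congr rfl (g := fun _ => α * β), Finset.prod_const, Finset.card_range]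
  intro k _
  by_cases hk : Even k
  · rw [if_pos hk, if_neg (Nat.not_even_iff_odd.2 hk.add_one)]
  · rw [if_neg hk, if_pos (Nat.not_even_iff_odd.1 hk).add_one, mul_comm]

/-- The restricted weak type inequality for a monotone weight, before solving for the incidence
measure. -/
theorem le_of_lt_flagMeasure (h : MonotoneModel C I γ γ' w) (hE : MeasurableSet E)
    (hF : MeasurableSet F) {T e f : ℝ} (hT : 0 < T) (he : 0 < e) (hf : 0 < f)
    (heE : volume E = ENNReal.ofReal e) (hfF : volume F = ENNReal.ofReal f)
    (hTlt : ENNReal.ofReal T < flagMeasure d w (flags γ I E F)) :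
    C * (T / (24 * Real.exp 1 * (d + 1) * e)) ^ ((d : ℝ) * (d - 1) / 2) *
      ((T / (4 * (d + 1) * f)) * ((T / (4 * (d + 1) * f)) *
        (T / (24 * Real.exp 1 * (d + 1) * e))) ^ d) ≤ e := by
  have hexp := Real.exp_pos 1
  -- Both thresholds make the loss per refinement, `2 * α * f` or `12 * exp 1 * β * e`, equal to `T
  -- / (2 * (d + 1))`, so `d + 1` refinements lose at most `T / 2`.
  set α := T / (4 * (d + 1) * f) with hα
  set β := T / (24 * Real.exp 1 * (d + 1) * e) with hβ
  have hα0 : 0 < α := by positivity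
  have hβ0 : 0 < β := by positivity
  have hne := h.refined_nonempty hE hF hα0 hβ0 (η := ENNReal.ofReal (T / (2 * (d + 1))))
    (by
      rw [hfF, ← ENNReal.ofReal_mul (by positivity)]
      refine ENNReal.ofReal_le_ofReal (le_of_eq ?_)
      rw [hα]; field_simp; norm_num)
    (by
      rw [heE, ← ENNReal.ofReal_mul (by positivity)]
      refine ENNReal.ofReal_le_ofReal (le_of_eq ?_)
      rw [hβ]; field_simp; norm_num) (d + 1)
    (by
      refine lt_of_le_of_lt ?_ hTlt
      rw [← ENNReal.ofReal_natCast, ← ENNReal.ofReal_mul (by positivity)]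
      refine ENNReal.ofReal_le_ofReal ?_
      push_cast
      have : ((d : ℝ) + 1) * (T / (2 * (d + 1))) = T / 2 := by field_simp
      linarith)
  have hvol := h.le_volume_of_refined_nonempty hE hF hα0 hβ0 hne
  have hmass : ∀ k, 0 ≤ (if Even k then α else β) ∧ (if Even k then α else β) ≤ moveMass α β k := by
    intro k
    unfold moveMass
    split_ifs
    · exact ⟨hα0.le, le_rfl⟩
    · refine ⟨hβ0.le, le_mul_of_one_le_left hβ0.le ?_⟩
      have := Real.one_le_exp (zero_le_one (α := ℝ))
      linarith
  have hκ : 0 ≤ C * β ^ ((d : ℝ) * (d - 1) / 2) *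
      ∏ k ∈ Finset.range d, if Even k then α else β :=
    mul_nonneg (mul_nonneg h.const_pos.le (by positivity))
      (Finset.prod_nonneg fun k _ => (hmass k).1)
  rw [← ENNReal.ofReal_prod_of_nonneg fun k _ => (hmass k).1.trans (hmass k).2,
    ← ENNReal.ofReal_mul hκ, heE, ENNReal.ofReal_le_ofReal_iff he.le] at hvol
  refine le_trans (le_trans (le_of_eq ?_) (mul_le_mul_of_nonneg_left
    (Finset.prod_le_prod (fun k _ => (hmass k).1) fun k _ => (hmass k).2) hκ)) hvol
  rw [mul_assoc _ (∏ k ∈ Finset.range d, _), prod_range_parity]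

end MonotoneModel

/-- The constant in the inequality for monotone weights. -/
noncomputable def monotoneConst (d : ℕ) (C : ℝ) : ℝ :=
  ((24 * Real.exp 1 * (d + 1)) ^ ((d : ℝ) * (d + 1) / 2) * (4 * (d + 1)) ^ ((d : ℝ) + 1) / C) ^
    (2 / (((d : ℝ) + 1) * (d + 2)))

/-- Collecting powers gives `T ^ N ≲ e ^ ((d ^ 2 + d + 2) / 2) * f ^ (d + 1)` with `N = (d + 1) * (d
+ 2) / 2`; the `N`-th root produces the exponents `1 / p_d` and `1 / q_d'`. -/
theorem le_rpow_of_mul_le {d : ℕ} {C T e f : ℝ} (hC : 0 < C) (hT : 0 < T) (he : 0 < e)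
    (hf : 0 < f)
    (h : C * (T / (24 * Real.exp 1 * (d + 1) * e)) ^ ((d : ℝ) * (d - 1) / 2) *
      ((T / (4 * (d + 1) * f)) * ((T / (4 * (d + 1) * f)) *
        (T / (24 * Real.exp 1 * (d + 1) * e))) ^ d) ≤ e) :
    T ≤ monotoneConst d C * e ^ (1 / pExp d) * f ^ (1 / qExpDual d) := by
  have hexp := Real.exp_pos 1
  set a : ℝ := 4 * (d + 1) with ha
  set b : ℝ := 24 * Real.exp 1 * (d + 1) with hb
  have ha0 : 0 < a := by positivity
  have hb0 : 0 < b := by positivity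
  set N : ℝ := ((d : ℝ) + 1) * (d + 2) / 2 with hN
  have hN0 : 0 < N := by positivity
  have h1 : T ^ N ≤ b ^ ((d : ℝ) * (d + 1) / 2) * a ^ ((d : ℝ) + 1) / C *
      (e ^ (((d : ℝ) ^ 2 + d + 2) / 2) * f ^ ((d : ℝ) + 1)) := by
    have e1 : C * (T / (b * e)) ^ ((d : ℝ) * (d - 1) / 2) *
        ((T / (a * f)) * ((T / (a * f)) * (T / (b * e))) ^ d) =
        C * T ^ N / ((b * e) ^ ((d : ℝ) * (d + 1) / 2) * (a * f) ^ ((d : ℝ) + 1)) := by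
      have e2 : (T / (b * e)) ^ ((d : ℝ) * (d - 1) / 2) * (T / (b * e)) ^ (d : ℝ) =
          (T / (b * e)) ^ ((d : ℝ) * (d + 1) / 2) := by
        rw [← Real.rpow_add (by positivity)]; congr 1; ring
      have e3 : (T / (a * f)) * (T / (a * f)) ^ (d : ℝ) = (T / (a * f)) ^ ((d : ℝ) + 1) := by
        rw [Real.rpow_add (by positivity), Real.rpow_one, mul_comm]
      have e4 : T ^ N = T ^ ((d : ℝ) * (d + 1) / 2) * T ^ ((d : ℝ) + 1) := by
        rw [← Real.rpow_add hT, hN]; congr 1; ring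
      rw [mul_pow, ← Real.rpow_natCast, ← Real.rpow_natCast (T / (b * e))]
      calc _ = C * ((T / (b * e)) ^ ((d : ℝ) * (d - 1) / 2) * (T / (b * e)) ^ (d : ℝ)) *
            ((T / (a * f)) * (T / (a * f)) ^ (d : ℝ)) := by ring
        _ = _ := by
          rw [e2, e3, e4, Real.div_rpow hT.le (by positivity), Real.div_rpow hT.le (by positivity)]
          field_simp
    rw [e1, div_le_iff₀ (by positivity)] at h
    have e5 : e * ((b * e) ^ ((d : ℝ) * (d + 1) / 2) * (a * f) ^ ((d : ℝ) + 1)) =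
        b ^ ((d : ℝ) * (d + 1) / 2) * a ^ ((d : ℝ) + 1) *
          (e ^ (((d : ℝ) ^ 2 + d + 2) / 2) * f ^ ((d : ℝ) + 1)) := by
      rw [Real.mul_rpow hb0.le he.le, Real.mul_rpow ha0.le hf.le]
      have : e ^ (((d : ℝ) ^ 2 + d + 2) / 2) = e * e ^ ((d : ℝ) * (d + 1) / 2) := by
        conv_rhs => rw [← Real.rpow_one e]
        rw [Real.rpow_one, ← Real.rpow_one_add' he.le (by positivity)]
        congr 1; ring
      rw [this]; ring
    rw [e5] at h
    rw [div_mul_eq_mul_div, le_div_iff₀ hC, mul_comm]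
    exact h
  have h2 := Real.rpow_le_rpow (by positivity) h1 (inv_nonneg.2 hN0.le)
  rw [← Real.rpow_mul hT.le, mul_inv_cancel₀ hN0.ne', Real.rpow_one,
    Real.mul_rpow (y := e ^ _ * f ^ _) (by positivity) (by positivity),
    Real.mul_rpow (x := e ^ _) (by positivity) (by positivity), ← Real.rpow_mul he.le, ← Real.rpow_mul hf.le] at h2
  have e6 : N⁻¹ = 2 / (((d : ℝ) + 1) * (d + 2)) := by rw [hN, inv_div]
  have e7 : ((d : ℝ) ^ 2 + d + 2) / 2 * N⁻¹ = 1 / pExp d := by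
    rw [e6, pExp]; field_simp
  have e8 : ((d : ℝ) + 1) * N⁻¹ = 1 / qExpDual d := by
    rw [e6, qExpDual]; field_simp
  rw [e7, e8, e6] at h2
  rw [mul_assoc]
  exact h2

namespace MonotoneModel

variable {d : ℕ} {C : ℝ} {I : Set ℝ} {γ γ' : ℝ → Fin d → ℝ} {w : ℝ → ℝ}
  {E F : Set (ℝ × (Fin d → ℝ))}

/-- The restricted weak type inequality for a monotone weight. -/
theorem flagMeasure_flags_le (h : MonotoneModel C I γ γ' w) (hE : MeasurableSet E)
    (hF : MeasurableSet F) (hEf : volume E < ∞) (hFf : volume F < ∞) :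
    flagMeasure d w (flags γ I E F) ≤ ENNReal.ofReal (monotoneConst d C) *
      volume E ^ (1 / pExp d) * volume F ^ (1 / qExpDual d) := by
  by_cases h0 : volume E = 0 ∨ volume F = 0
  · rw [flagMeasure_flags_eq_zero h.measurable_curve h.measurable_weight h.isOpen.measurableSet
      hE hF h0]
    exact zero_le
  push Not at h0
  obtain ⟨e, he⟩ : ∃ e, e = (volume E).toReal := ⟨_, rfl⟩
  obtain ⟨f, hf⟩ : ∃ f, f = (volume F).toReal := ⟨_, rfl⟩
  have he0 : 0 < e := he ▸ ENNReal.toReal_pos h0.1 hEf.ne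
  have hf0 : 0 < f := hf ▸ ENNReal.toReal_pos h0.2 hFf.ne
  have heE : volume E = ENNReal.ofReal e := by rw [he, ENNReal.ofReal_toReal hEf.ne]
  have hfF : volume F = ENNReal.ofReal f := by rw [hf, ENNReal.ofReal_toReal hFf.ne]
  have hK : 0 ≤ monotoneConst d C := by
    have := h.const_pos
    have := Real.exp_pos 1
    unfold monotoneConst; positivity
  -- The measure of the flags is not known to be finite, so the estimate is applied to every finite
  -- value below it.
  refine ENNReal.le_of_forall_nnreal_lt fun r hr => ?_
  rcases eq_or_ne r 0 with rfl | hr0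
  · simp
  have hr0' : 0 < (r : ℝ) := NNReal.coe_pos.2 (pos_iff_ne_zero.2 hr0)
  have := le_rpow_of_mul_le h.const_pos hr0' he0 hf0
    (h.le_of_lt_flagMeasure hE hF hr0' he0 hf0 heE hfF (by rwa [ENNReal.ofReal_coe_nnreal]))
  rw [heE, hfF, ENNReal.ofReal_rpow_of_pos he0, ENNReal.ofReal_rpow_of_pos hf0,
    ← ENNReal.ofReal_mul hK, ← ENNReal.ofReal_mul (by positivity), ← ENNReal.ofReal_coe_nnreal]
  exact ENNReal.ofReal_le_ofReal this

end MonotoneModel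

/-! ### Reduction to monotone weights -/

section Reduction

variable {d : ℕ} {γ : ℝ → Fin d → ℝ} {I J : Set ℝ} {f : ℝ → ℝ} {Cγ c₁ c₂ : ℝ}

theorem abs_jacobian {t : Fin d → ℝ} (ht : ∀ j, DifferentiableAt ℝ γ (t j)) :
    |jacobian γ t| = |(Matrix.of fun i j => deriv γ (t j) i).det| := by
  have hd : HasFDerivAt (alternatingSum γ) (∑ j : Fin d, (-1 : ℝ) ^ ((j : ℕ) + 1) •
      (ContinuousLinearMap.proj (R := ℝ) (φ := fun _ : Fin d => ℝ) j).smulRight (deriv γ (t j))) t := by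
    have : alternatingSum γ = fun t => ∑ j : Fin d, (-1 : ℝ) ^ ((j : ℕ) + 1) • γ (t j) := rfl
    rw [this]
    refine HasFDerivAt.fun_sum fun j _ => HasFDerivAt.fun_const_smul ?_ _
    have e : (ContinuousLinearMap.proj (R := ℝ) (φ := fun _ : Fin d => ℝ) j).smulRight
        (deriv γ (t j)) = (ContinuousLinearMap.toSpanSingleton ℝ (deriv γ (t j))).comp
          (ContinuousLinearMap.proj (R := ℝ) (φ := fun _ : Fin d => ℝ) j) := by
      ext v i
      simp
    rw [e]
    exact (ht j).hasDerivAt.hasFDerivAt.comp t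
      (ContinuousLinearMap.proj (R := ℝ) (φ := fun _ : Fin d => ℝ) j).hasFDerivAt
  have hM : LinearMap.toMatrix' ((fderiv ℝ (alternatingSum γ) t : (Fin d → ℝ) →L[ℝ] (Fin d → ℝ)) :
      (Fin d → ℝ) →ₗ[ℝ] (Fin d → ℝ)) =
      Matrix.of fun i j : Fin d =>
        (-1 : ℝ) ^ ((j : ℕ) + 1) * (Matrix.of fun i j => deriv γ (t j) i) i j := by
    ext i j
    rw [LinearMap.toMatrix'_apply, hd.fderiv]
    have e : ∀ c : Fin d, (((-1 : ℝ) ^ ((c : ℕ) + 1) •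
        (ContinuousLinearMap.proj (R := ℝ) (φ := fun _ : Fin d => ℝ) c).smulRight
          (deriv γ (t c))) (Pi.single j 1)) i =
        if c = j then (-1 : ℝ) ^ ((j : ℕ) + 1) * deriv γ (t j) i else 0 := fun c => by
      by_cases h : c = j
      · subst h; simp
      · simp [h]
    rw [ContinuousLinearMap.coe_coe, sum_apply, Finset.sum_apply,
      Finset.sum_congr rfl fun c _ => e c]
    simp
  rw [jacobian, ContinuousLinearMap.det, ← LinearMap.det_toMatrix', hM, Matrix.det_mul_row, abs_mul,
    Finset.abs_prod]
  simp

theorem measurable_indicator_of_continuousOn {X : Type*} [TopologicalSpace X] [MeasurableSpace X]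
    [BorelSpace X] [Zero X] (hJ : MeasurableSet J) {g : ℝ → X} (hg : ContinuousOn g J) :
    Measurable (J.indicator g) := by
  classical
  rw [← piecewise_eq_indicator]
  exact hg.measurable_piecewise continuousOn_const hJ

theorem LogConcaveOn.mono (hf : LogConcaveOn I f) (hJ : J ⊆ I) : LogConcaveOn J f :=
  ⟨fun t ht => hf.1 t (hJ ht), fun t₁ h₁ t₂ h₂ => hf.2 t₁ (hJ h₁) t₂ (hJ h₂)⟩

/-- Quasi-concavity. It makes the positivity set of `f` an interval and yields the splitting into
monotone pieces. -/
theorem LogConcaveOn.min_le (hf : LogConcaveOn I f) {a b t : ℝ} (ha : a ∈ I) (hb : b ∈ I)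
    (hat : a ≤ t) (htb : t ≤ b) : min (f a) (f b) ≤ f t := by
  rcases (hat.trans htb).eq_or_lt with h | h
  · have : a = t := le_antisymm hat (h ▸ htb)
    rw [← this]; exact min_le_left _ _
  have hba : 0 < b - a := sub_pos.2 h
  set θ := (b - t) / (b - a) with hθ
  have h0 : 0 ≤ θ := div_nonneg (by linarith) hba.le
  have h1 : θ ≤ 1 := (div_le_one hba).2 (by linarith)
  have e : θ * a + (1 - θ) * b = t := by
    rw [hθ]; field_simp; ring
  have key := hf.2 a ha b hb θ h0 h1
  rw [e] at key
  refine le_trans ?_ key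
  have hm : 0 ≤ min (f a) (f b) := le_min (hf.1 a ha) (hf.1 b hb)
  calc min (f a) (f b) = min (f a) (f b) ^ θ * min (f a) (f b) ^ (1 - θ) := by
        rw [← Real.rpow_add_of_nonneg hm h0 (by linarith)]; simp
    _ ≤ f a ^ θ * f b ^ (1 - θ) := mul_le_mul
        (Real.rpow_le_rpow hm (min_le_left _ _) h0)
        (Real.rpow_le_rpow hm (min_le_right _ _) (by linarith))
        (Real.rpow_nonneg hm _) (Real.rpow_nonneg (hf.1 a ha) _)

theorem LogConcaveOn.continuousOn (hf : LogConcaveOn J f) (hJ : IsOpen J) (hJc : J.OrdConnected)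
    (hpos : ∀ t ∈ J, 0 < f t) : ContinuousOn f J := by
  have := (hf.concaveOn_log hJc hpos).continuousOn hJ
  exact (Real.continuous_exp.comp_continuousOn this).congr fun t ht =>
    (Real.exp_log (hpos t ht)).symm

/-- On an interval where the comparison function is positive and, after a possible reflection `σ`,
monotone, the curve and the weight satisfy the monotone model. -/
theorem monotoneModel_of_reflection (hd : 1 ≤ d) (hCγ : 0 < Cγ) (hc₁ : 0 < c₁) (hI : IsOpen I)
    (hγ : ContDiffOn ℝ (d : WithTop ℕ∞) γ I) (hgeo : GeometricInequality Cγ I γ)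
    (hf : LogConcaveOn I f) (hfγ : ∀ t ∈ I, c₁ * f t ≤ affineDensity γ t) (hJI : J ⊆ I)
    (hJ : IsOpen J) (hJc : J.OrdConnected) (hpos : ∀ t ∈ J, 0 < f t) {σ : ℝ} (hσ : |σ| = 1)
    (hmono : MonotoneOn (fun t => f (σ * t)) {t | σ * t ∈ J}) :
    MonotoneModel (Cγ * (c₁ ^ (((d : ℝ) + 1) / 2)) ^ d) {t | σ * t ∈ J}
      (fun t => J.indicator γ (σ * t)) (fun t => σ • deriv γ (σ * t))
      (fun t => J.indicator (fun r => f r ^ (1 / qExp d)) (σ * t)) := by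
  have hd0 : (0 : ℝ) < d := by exact_mod_cast hd
  have hq : 0 ≤ 1 / qExp d := by unfold qExp; positivity
  have hcont : Continuous fun t : ℝ => σ * t := by fun_prop
  have hJm := hJ.measurableSet
  have hlcJ := (hf.mono hJI)
  have hlc := hlcJ.rpow hq
  have hwpos : ∀ t ∈ J, 0 < f t ^ (1 / qExp d) := fun t ht => Real.rpow_pos_of_pos (hpos t ht) _
  have hconv : ∀ {a b θ : ℝ}, a ∈ J → b ∈ J → 0 ≤ θ → θ ≤ 1 → θ * a + (1 - θ) * b ∈ J :=
    fun ha hb h0 h1 => (convex_iff_ordConnected.2 hJc) ha hb h0 (by linarith) (by ring)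
  have hdiff : ∀ t ∈ I, DifferentiableAt ℝ γ t := fun t ht =>
    (hγ.contDiffAt (hI.mem_nhds ht)).differentiableAt (by
      have : d ≠ 0 := by omega
      exact_mod_cast this)
  have hσσ : σ * σ = 1 := by rw [← sq, ← sq_abs, hσ, one_pow]
  refine ⟨hd, by positivity, hJ.preimage hcont, ?_, ?_, ?_, ?_, ?_, ?_, ?_, ?_, ?_⟩
  · refine convex_iff_ordConnected.1 fun a ha b hb x y hx hy hxy => ?_
    have : σ * (x • a + y • b) = x • (σ * a) + y • (σ * b) := by simp only [smul_eq_mul]; ring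
    change σ * (x • a + y • b) ∈ J
    rw [this]
    exact (convex_iff_ordConnected.2 hJc) ha hb hx hy hxy
  · exact (measurable_indicator_of_continuousOn hJm (hγ.continuousOn.mono hJI)).comp
      hcont.measurable
  · exact (measurable_indicator_of_continuousOn hJm (hlc.continuousOn hJ hJc hwpos)).comp
      hcont.measurable
  · intro t ht
    have h1 : HasDerivAt (J.indicator γ) (deriv γ (σ * t)) (σ * t) :=
      (hdiff _ (hJI ht)).hasDerivAt.congr_of_eventuallyEq
        (by filter_upwards [hJ.mem_nhds ht] with r hr using indicator_of_mem hr _)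
    have h2 : HasDerivAt (fun t : ℝ => σ * t) σ t := by
      simpa using (hasDerivAt_id t).const_mul σ
    exact h1.scomp t h2
  · have h1 : ContinuousOn (deriv γ) I := hγ.continuousOn_deriv_of_isOpen hI (by exact_mod_cast hd)
    exact ((h1.mono hJI).comp hcont.continuousOn fun t ht => ht).const_smul σ
  · intro t ht
    rw [indicator_of_mem (show σ * t ∈ J from ht)]
    exact hwpos _ ht
  · refine ⟨fun t ht => ?_, fun a ha b hb θ h0 h1 => ?_⟩
    · change 0 ≤ J.indicator (fun r => f r ^ (1 / qExp d)) (σ * t)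
      rw [indicator_of_mem (show σ * t ∈ J from ht)]
      exact (hwpos _ ht).le
    · have e : σ * (θ * a + (1 - θ) * b) = θ * (σ * a) + (1 - θ) * (σ * b) := by ring
      simp only [e]
      rw [indicator_of_mem (show σ * a ∈ J from ha), indicator_of_mem (show σ * b ∈ J from hb),
        indicator_of_mem (hconv ha hb h0 h1)]
      exact hlc.2 _ ha _ hb θ h0 h1
  · intro a ha b hb hab
    simp only
    rw [indicator_of_mem (show σ * a ∈ J from ha), indicator_of_mem (show σ * b ∈ J from hb)]
    exact Real.rpow_le_rpow (hpos _ ha).le (hmono ha hb hab) hq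
  · intro z hz
    have h1 := hgeo (fun j => σ * z j) fun j => hJI (hz j)
    rw [abs_jacobian fun j => hdiff _ (hJI (hz j))] at h1
    have h2 : |(Matrix.of fun i j : Fin d => (σ • deriv γ (σ * z j)) i).det| =
        |(Matrix.of fun i j : Fin d => deriv γ (σ * z j) i).det| := by
      have := Matrix.det_mul_row (fun _ : Fin d => σ) (Matrix.of fun i j : Fin d => deriv γ (σ * z j) i)
      have e : (Matrix.of fun i j : Fin d => (σ • deriv γ (σ * z j)) i) =
        Matrix.of fun i j : Fin d => σ * (Matrix.of fun i j : Fin d => deriv γ (σ * z j) i) i j := rfl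
      rw [e, this, abs_mul, Finset.abs_prod]
      simp [hσ]
    rw [h2]
    refine le_trans ?_ h1
    have h3 : ∀ i j : Fin d, |σ * z j - σ * z i| = |z j - z i| := fun i j => by
      rw [← mul_sub, abs_mul, hσ, one_mul]
    simp only [h3]
    refine mul_le_mul_of_nonneg_right ?_
      (Finset.prod_nonneg fun i _ => Finset.prod_nonneg fun j _ => abs_nonneg _)
    have h4 : (c₁ ^ (((d : ℝ) + 1) / 2)) ^ d = ∏ _j : Fin d, c₁ ^ (((d : ℝ) + 1) / 2) := by simp
    rw [h4, mul_assoc, ← Finset.prod_mul_distrib]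
    refine mul_le_mul_of_nonneg_left (Finset.prod_le_prod (fun j _ => ?_) fun j _ => ?_) hCγ.le
    · rw [indicator_of_mem (show σ * z j ∈ J from hz j)]
      have := hwpos _ (hz j)
      positivity
    · rw [indicator_of_mem (show σ * z j ∈ J from hz j)]
      have hfj := hpos _ (hz j)
      -- Both sides are brought to the exponent `(d + 1) / 2`, of the affine density here and of `f`
      -- in `e2`. The comparison then costs `c₁ ^ ((d + 1) / 2)` for each of the `d` points.
      have e1 : |torsion γ (σ * z j)| ^ ((1 : ℝ) / d) =
          affineDensity γ (σ * z j) ^ (((d : ℝ) + 1) / 2) := by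
        rw [affineDensity, ← Real.rpow_mul (abs_nonneg _)]
        congr 1; field_simp
      have e2 : (f (σ * z j) ^ (1 / qExp d)) ^ ((((d : ℝ) + 1) * ((d : ℝ) + 2)) / (2 * d)) =
          f (σ * z j) ^ (((d : ℝ) + 1) / 2) := by
        rw [← Real.rpow_mul hfj.le, qExp]
        congr 1; field_simp
      rw [e1, e2, ← Real.mul_rpow hc₁.le hfj.le]
      exact Real.rpow_le_rpow (by positivity) (hfγ _ (hJI (hz j))) (by positivity)

theorem measurePreserving_reflection {σ : ℝ} (hσ : |σ| = 1) :
    MeasurePreserving (fun z : ℝ × (Fin d → ℝ) => (σ * z.1, z.2)) := by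
  have h1 : MeasurePreserving (fun t : ℝ => σ * t) := by
    rcases eq_or_eq_neg_of_abs_eq hσ with h | h
    · subst h; simp only [one_mul]; exact MeasurePreserving.id volume
    · subst h; simp only [neg_one_mul]; exact Measure.measurePreserving_neg volume
  exact h1.prod (MeasurePreserving.id volume)

/-- The bound for the part of the pairing over an interval of monotonicity. -/
theorem weightedPairing_le_of_reflection (hd : 1 ≤ d) (hCγ : 0 < Cγ) (hc₁ : 0 < c₁) (hc₂ : 0 < c₂)
    (hI : IsOpen I) (hγ : ContDiffOn ℝ (d : WithTop ℕ∞) γ I) (hgeo : GeometricInequality Cγ I γ)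
    (hf : LogConcaveOn I f) (hfγ : ∀ t ∈ I, c₁ * f t ≤ affineDensity γ t ∧
      affineDensity γ t ≤ c₂ * f t) (hJI : J ⊆ I)
    (hJ : IsOpen J) (hJc : J.OrdConnected) (hpos : ∀ t ∈ J, 0 < f t) {σ : ℝ} (hσ : |σ| = 1)
    (hmono : MonotoneOn (fun t => f (σ * t)) {t | σ * t ∈ J}) {E F : Set (ℝ × (Fin d → ℝ))}
    (hE : MeasurableSet E) (hF : MeasurableSet F) (hEf : volume E < ∞) (hFf : volume F < ∞) :
    weightedPairing J γ E F ≤ ENNReal.ofReal (c₂ ^ (1 / qExp d)) *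
      (ENNReal.ofReal (monotoneConst d (Cγ * (c₁ ^ (((d : ℝ) + 1) / 2)) ^ d)) *
        volume E ^ (1 / pExp d) * volume F ^ (1 / qExpDual d)) := by
  have hM := monotoneModel_of_reflection hd hCγ hc₁ hI hγ hgeo hf (fun t ht => (hfγ t ht).1) hJI hJ
    hJc hpos hσ hmono
  have hσσ : σ * σ = 1 := by rw [← sq, ← sq_abs, hσ, one_pow]
  have hq : 0 ≤ 1 / qExp d := by unfold qExp; positivity
  have hmp := measurePreserving_reflection (d := d) hσ
  -- Reflecting the curve parameter relabels the lines and leaves the points alone, so only `F` has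
  -- to be transported.
  set Fσ := (fun z : ℝ × (Fin d → ℝ) => (σ * z.1, z.2)) ⁻¹' F with hFσ
  have hFσm : MeasurableSet Fσ := hmp.measurable hF
  have hFσv : volume Fσ = volume F := hmp.measure_preimage hF.nullMeasurableSet
  have hmain := hM.flagMeasure_flags_le hE hFσm hEf (by rw [hFσv]; exact hFf)
  rw [hFσv] at hmain
  refine le_trans ?_ (mul_le_mul_right hmain _)
  set γσ : ℝ → Fin d → ℝ := fun t => J.indicator γ (σ * t) with hγσ
  set wσ : ℝ → ℝ := fun t => J.indicator (fun r => f r ^ (1 / qExp d)) (σ * t) with hwσ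
  set Jσ : Set ℝ := {t | σ * t ∈ J} with hJσ
  have hfl := measurableSet_flags hM.measurable_curve hM.isOpen.measurableSet hE hFσm
  have hind := measurable_indicator_weight hM.measurable_weight hfl
  rw [flagMeasure_apply hfl, lintegral_eq_lintegral_lines hM.measurable_curve hind]
  have hinner : Measurable fun u : (ℝ × (Fin d → ℝ)) × ℝ => (flags γσ Jσ E Fσ).indicator
      (fun φ : ℝ × ℝ × (Fin d → ℝ) => ENNReal.ofReal (wσ φ.2.1))
        (u.2, u.1.1, u.1.2 + u.2 • γσ u.1.1) := by
    have := hM.measurable_curve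
    exact hind.comp (by fun_prop)
  rw [← hmp.lintegral_comp hinner.lintegral_prod_right', ← lintegral_const_mul]
  swap
  · exact hinner.lintegral_prod_right'.comp hmp.measurable
  unfold weightedPairing
  rw [← lintegral_indicator (hJ.measurableSet.prod MeasurableSet.univ)]
  refine lintegral_mono fun z => ?_
  obtain ⟨t, x⟩ := z
  by_cases ht : t ∈ J
  swap
  · rw [indicator_of_notMem (fun h => ht h.1)]; exact zero_le
  rw [indicator_of_mem (show (t, x) ∈ J ×ˢ univ from ⟨ht, mem_univ _⟩)]
  by_cases hxF : (t, x) ∈ F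
  swap
  · rw [indicator_of_notMem hxF, mul_zero]; exact zero_le
  rw [indicator_of_mem hxF, mul_one]
  have e0 : σ * (σ * t) = t := by rw [← mul_assoc, hσσ, one_mul]
  have eγ : γσ (σ * t) = γ t := by simp only [hγσ, e0, indicator_of_mem ht]
  have ew : wσ (σ * t) = f t ^ (1 / qExp d) := by simp only [hwσ, e0, indicator_of_mem ht]
  have e1 : ∫⁻ s : ℝ, (flags γσ Jσ E Fσ).indicator
      (fun φ : ℝ × ℝ × (Fin d → ℝ) => ENNReal.ofReal (wσ φ.2.1)) (s, σ * t, x + s • γσ (σ * t)) =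
      ENNReal.ofReal (f t ^ (1 / qExp d)) * restrictedXray γ (E.indicator fun _ => 1) (t, x) := by
    rw [restrictedXray, xray, ← lintegral_const_mul']
    swap
    · exact ENNReal.ofReal_ne_top
    refine lintegral_congr fun s => ?_
    rw [eγ]
    by_cases hs : (s, x + s • γ t) ∈ E
    · rw [indicator_of_mem hs, mul_one, indicator_of_mem, ew]
      refine ⟨?_, hs, ?_⟩
      · change σ * (σ * t) ∈ J
        rwa [e0]
      · change (σ * (σ * t), x + s • γ t - s • γσ (σ * t)) ∈ F
        rw [e0, eγ, add_sub_cancel_right]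
        exact hxF
    · rw [indicator_of_notMem hs, mul_zero, indicator_of_notMem]
      exact fun h => hs h.2.1
  change _ ≤ ENNReal.ofReal (c₂ ^ (1 / qExp d)) * ∫⁻ s : ℝ, (flags γσ Jσ E Fσ).indicator
      (fun φ : ℝ × ℝ × (Fin d → ℝ) => ENNReal.ofReal (wσ φ.2.1)) (s, σ * t, x + s • γσ (σ * t))
  rw [e1, ← mul_assoc, ← ENNReal.ofReal_mul (by positivity),
    ← Real.mul_rpow hc₂.le (hpos t ht).le]
  refine mul_le_mul_left (ENNReal.ofReal_le_ofReal (Real.rpow_le_rpow ?_ (hfγ t (hJI ht)).2 hq)) _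
  unfold affineDensity
  positivity

/-- Decomposition of the pairing into two intervals of monotonicity. -/
theorem weightedPairing_le_add (hd : 1 ≤ d) (hI : MeasurableSet I) (hf0 : ∀ t ∈ I, 0 ≤ f t)
    (hfγ : ∀ t ∈ I, affineDensity γ t ≤ c₂ * f t) {J₁ J₂ A : Set ℝ} (hA : MeasurableSet A)
    (hAf : {t ∈ I | 0 < f t} = A) (hAJ : volume (A \ (J₁ ∪ J₂)) = 0)
    (E F : Set (ℝ × (Fin d → ℝ))) :
    weightedPairing I γ E F ≤ weightedPairing J₁ γ E F + weightedPairing J₂ γ E F := by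
  have hd0 : (0 : ℝ) < d := by exact_mod_cast hd
  set V : Set (Fin d → ℝ) := univ
  have hcover : I ×ˢ V ⊆ (((I \ A) ×ˢ V) ∪ ((A \ (J₁ ∪ J₂)) ×ˢ V)) ∪ ((J₁ ×ˢ V) ∪ (J₂ ×ˢ V)) := by
    rintro ⟨t, x⟩ ⟨ht, -⟩
    by_cases h1 : t ∈ A
    · by_cases h2 : t ∈ J₁ ∪ J₂
      · rcases h2 with h2 | h2
        · exact Or.inr (Or.inl ⟨h2, mem_univ _⟩)
        · exact Or.inr (Or.inr ⟨h2, mem_univ _⟩)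
      · exact Or.inl (Or.inr ⟨⟨h1, h2⟩, mem_univ _⟩)
    · exact Or.inl (Or.inl ⟨⟨ht, h1⟩, mem_univ _⟩)
  unfold weightedPairing
  refine (lintegral_mono_set hcover).trans ((lintegral_union_le _ _ _).trans ?_)
  refine (add_le_add ((lintegral_union_le _ _ _).trans (le_of_eq ?_))
    (lintegral_union_le _ _ _)).trans (zero_add _).le
  -- Off `A` the comparison function vanishes, hence so do the affine density and, as `1 / q_d` is
  -- nonzero, its power.
  have hz1 : ∫⁻ z in (I \ A) ×ˢ V, ENNReal.ofReal (affineDensity γ z.1 ^ (1 / qExp d)) *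
      restrictedXray γ (E.indicator fun _ => 1) z * F.indicator (fun _ => 1) z = 0 := by
    refine lintegral_eq_zero_of_ae_eq_zero ?_
    refine (ae_restrict_iff' ((hI.diff hA).prod MeasurableSet.univ)).2
      (Filter.Eventually.of_forall fun z hz => ?_)
    have h0 : f z.1 = 0 := by
      refine le_antisymm (not_lt.1 fun hp => hz.1.2 ?_) (hf0 _ hz.1.1)
      rw [← hAf]; exact ⟨hz.1.1, hp⟩
    have h1 : affineDensity γ z.1 = 0 := by
      refine le_antisymm ?_ (by unfold affineDensity; positivity)
      simpa [h0] using hfγ _ hz.1.1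
    have h2 : 1 / qExp d ≠ 0 := by unfold qExp; positivity
    simp only [h1, Real.zero_rpow h2, ENNReal.ofReal_zero, zero_mul, Pi.zero_apply]
  have hz2 : volume ((A \ (J₁ ∪ J₂)) ×ˢ V) = 0 := by
    rw [Measure.volume_eq_prod, Measure.prod_prod, hAJ, zero_mul]
  rw [hz1, setLIntegral_measure_zero _ _ hz2, add_zero]

theorem volume_diff_interior_of_ordConnected {A : Set ℝ} (hA : A.OrdConnected) :
    volume (A \ interior A) = 0 :=
  measure_mono_null (sdiff_subset_sdiff_left subset_closure)
    (Convex.addHaar_frontier volume (convex_iff_ordConnected.2 hA))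

end Reduction

end RestrictedXray

/-! ### The theorem, by splitting into a rising and a falling piece. -/

theorem proposition3p2 (d : ℕ) (hd : 1 ≤ d) (Cγ c₁ c₂ : ℝ)
    (hCγ : 0 < Cγ) (hc₁ : 0 < c₁) (hc₂ : 0 < c₂) :
    ∃ C : ℝ≥0, ∀ (I : Set ℝ) (γ : ℝ → Fin d → ℝ) (f : ℝ → ℝ),
      IsOpen I → I.OrdConnected →
      ContDiffOn ℝ (d : WithTop ℕ∞) γ I →
      RestrictedXray.GeometricInequality Cγ I γ →
      RestrictedXray.LogConcaveOn I f →
      (∀ t ∈ I, c₁ * f t ≤ RestrictedXray.affineDensity γ t ∧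
        RestrictedXray.affineDensity γ t ≤ c₂ * f t) →
      ∀ E F : Set (ℝ × (Fin d → ℝ)),
        MeasurableSet E → MeasurableSet F → volume E < ∞ → volume F < ∞ →
        RestrictedXray.weightedPairing I γ E F ≤
          (C : ℝ≥0∞) * volume E ^ (1 / RestrictedXray.pExp d) *
            volume F ^ (1 / RestrictedXray.qExpDual d) := by
  refine ⟨2 * (Real.toNNReal (c₂ ^ (1 / RestrictedXray.qExp d)) * Real.toNNReal
    (RestrictedXray.monotoneConst d (Cγ * (c₁ ^ (((d : ℝ) + 1) / 2)) ^ d))), ?_⟩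
  intro I γ f hI hIc hγ hgeo hf hfγ E F hE hF hEf hFf
  set A : Set ℝ := {t ∈ I | 0 < f t} with hA
  have hAI : A ⊆ I := fun t ht => ht.1
  have hAc : A.OrdConnected := ⟨fun a ha b hb t ht => ⟨hIc.out ha.1 hb.1 ht,
    lt_of_lt_of_le (lt_min ha.2 hb.2) (hf.min_le ha.1 hb.1 ht.1 ht.2)⟩⟩
  -- The points where `f` dominates its past, and in `A₂` its future. This avoids choosing a
  -- maximiser, which need not exist. Interiors are taken later because the monotone model lives on
  -- open sets; the endpoints removed are null.
  set A₁ : Set ℝ := {t ∈ A | ∀ r ∈ A, r ≤ t → f r ≤ f t} with hA₁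
  set A₂ : Set ℝ := {t ∈ A | ∀ r ∈ A, t ≤ r → f r ≤ f t} with hA₂
  have hcov : A ⊆ A₁ ∪ A₂ := by
    intro t ht
    by_contra hn
    have h1 : ¬ ∀ r ∈ A, r ≤ t → f r ≤ f t := fun h => hn (Or.inl ⟨ht, h⟩)
    have h2 : ¬ ∀ r ∈ A, t ≤ r → f r ≤ f t := fun h => hn (Or.inr ⟨ht, h⟩)
    push Not at h1 h2
    obtain ⟨a, ha, hat, hfa⟩ := h1
    obtain ⟨b, hb, htb, hfb⟩ := h2
    exact absurd (hf.min_le ha.1 hb.1 hat htb) (not_le.2 (lt_min hfa hfb))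
  have hA₁c : A₁.OrdConnected := by
    refine ⟨fun a ha b hb t ht => ⟨hAc.out ha.1 hb.1 ht, fun r hr hrt => ?_⟩⟩
    have h1 := hf.min_le hr.1 hb.1.1 hrt ht.2
    rwa [min_eq_left (hb.2 r hr (hrt.trans ht.2))] at h1
  have hA₂c : A₂.OrdConnected := by
    refine ⟨fun a ha b hb t ht => ⟨hAc.out ha.1 hb.1 ht, fun r hr htr => ?_⟩⟩
    have h1 := hf.min_le ha.1.1 hr.1 ht.1 htr
    rwa [min_eq_right (ha.2 r hr (ht.1.trans htr))] at h1
  have hnull : volume (A \ (interior A₁ ∪ interior A₂)) = 0 := by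
    refine measure_mono_null (t := (A₁ \ interior A₁) ∪ (A₂ \ interior A₂)) ?_
      (measure_union_null (RestrictedXray.volume_diff_interior_of_ordConnected hA₁c)
        (RestrictedXray.volume_diff_interior_of_ordConnected hA₂c))
    rintro t ⟨ht, hn⟩
    rcases hcov ht with h | h
    · exact Or.inl ⟨h, fun hi => hn (Or.inl hi)⟩
    · exact Or.inr ⟨h, fun hi => hn (Or.inr hi)⟩
  have hsub₁ : interior A₁ ⊆ A := interior_subset.trans fun t ht => ht.1
  have hsub₂ : interior A₂ ⊆ A := interior_subset.trans fun t ht => ht.1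
  have h₁ := RestrictedXray.weightedPairing_le_of_reflection hd hCγ hc₁ hc₂ hI hγ hgeo hf hfγ
    (hsub₁.trans hAI) isOpen_interior hA₁c.interior (fun t ht => (hsub₁ ht).2) (σ := 1) (by simp)
    (fun a ha b hb hab => by
      simp only [one_mul, mem_ofPred_eq] at ha hb ⊢
      exact (interior_subset hb).2 a (hsub₁ ha) hab) hE hF hEf hFf
  have h₂ := RestrictedXray.weightedPairing_le_of_reflection hd hCγ hc₁ hc₂ hI hγ hgeo hf hfγ
    (hsub₂.trans hAI) isOpen_interior hA₂c.interior (fun t ht => (hsub₂ ht).2) (σ := -1) (by simp)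
    (fun a ha b hb hab => by
      simp only [mem_ofPred_eq] at ha hb ⊢
      exact (interior_subset hb).2 _ (hsub₂ ha) (by linarith)) hE hF hEf hFf
  refine (RestrictedXray.weightedPairing_le_add hd hI.measurableSet hf.1
    (fun t ht => (hfγ t ht).2) hAc.measurableSet rfl hnull E F).trans ((add_le_add h₁ h₂).trans
      (le_of_eq ?_))
  push_cast
  simp only [ENNReal.ofReal]
  ring
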